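/- **Lemma (exponential stability of the optimal state system).** Let $n_x,n_u\ge 0$, $T>0$, and let $A(t)\in\mathbb R^{n_x\times n_x}$, $B(t)\in\mathbb R^{n_x\times n_u}$, $Q(t)\in\mathbb R^{n_x\times n_x}$, $H(t)\in\mathbb R^{n_u\times n_x}$, $R(t)\in\mathbb R^{n_u\times n_u}$ $(t\in[0,T])$ be matrix functions and $Q_T\in\mathbb R^{n_x\times n_x}$ a matrix, with $Q(t)$, $R(t)$, $Q_T$ symmetric. $\|\cdot\|$ is the Euclidean operator norm, $\preceq$ is the Loewner order of symmetric matrices, and for continuous $M:[0,T]\to\mathbb R^{n\times n}$, $\Phi_M(t,s)$ $(s,t\in[0,T])$ is the evolution operator of $\dot x=M(t)x$, that is, $\partial_t\Phi_M(t,s)=M(t)\Phi_M(t,s)$, $\Phi_M(s,s)=I$. Suppose that: 1. $A,B,Q,H,R$ are continuous on $[0,T]$, with $\|A(t)\|\le\lambda_A$, $\|B(t)\|\le\lambda_B$, $\|Q(t)\|\le\lambda_Q$, $\|H(t)\|\le\lambda_H$, $\|R(t)\|\le\lambda_R$ for all $t\in[0,T]$, where $\lambda_A,\lambda_B,\lambda_Q,\lambda_H,\lambda_R>0$.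 2. (Uniform complete controllability.) There are $\sigma\in(0,T)$ and $\alpha_0,\alpha_1,\beta_0,\beta_1>0$ such that for every $t_0\in[0,T-\sigma]$ there is $t_1\in[t_0,t_0+\sigma]$ with $$\alpha_0I\preceq W(t_0,t_1)\preceq\alpha_1I,\qquad \beta_0I\preceq\Phi_A(t_1,t_0)W(t_0,t_1)\Phi_A(t_1,t_0)^\top\preceq\beta_1I,$$ where $W(t_0,t_1)=\int_{t_0}^{t_1}\Phi_A(t_0,s)B(s)B(s)^\top\Phi_A(t_0,s)^\top\,ds$. 3. There are $\gamma_R>0$ and $0<\gamma_Q\le\lambda_Q$ with $R(t)\succeq\gamma_RI$ and $Q(t)-H(t)^\top R(t)^{-1}H(t)\succeq\gamma_QI$ for all $t\in[0,T]$, and $\gamma_QI\preceq Q_T\preceq\lambda_QI$. Then the Riccati terminal value problem $$\dot S=SBR^{-1}B^\top S-S(A-BR^{-1}H)-(A-BR^{-1}H)^\top S-(Q-H^\top R^{-1}H)\ \text{ on }[0,T],\qquad S(T)=Q_T,$$ has a unique solution $S:[0,T]\to\mathbb R^{n_x\times n_x}$, and the closed-loop matrix $$Z(t)=A(t)-B(t)R(t)^{-1}H(t)-B(t)R(t)^{-1}B(t)^\top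 S(t)$$ satisfies $$\|\Phi_Z(t_1,t_0)\|\le\sqrt{\frac{c_1}{c_0}}\;\exp\Big(-\frac{\gamma_Q}{2c_1}(t_1-t_0)\Big)\qquad\text{for all }0\le t_0\le t_1\le T,$$ where the constants $c_0,c_1$ do not depend on $T$ and are given, with $\omega=\lambda_A+\lambda_B\lambda_H/\gamma_R$ and $$\tilde\alpha_0=\frac{1-e^{-2\omega\sigma}}{2\omega},\quad \tilde\alpha_1=\frac{e^{2\omega\sigma}-1}{2\omega},\quad \alpha_1'=\frac{\lambda_B^2(e^{2\sigma\omega}-1)}{2\omega},\quad \alpha_0'=\Big(\frac2{\alpha_0}+\frac{\lambda_H^2}{\gamma_R^2\lambda_A}\Big(1+\frac{\alpha_1}{\alpha_0}\Big)^2\big(e^{2\lambda_A\sigma}-1\big)\Big)^{-1},$$ by $$c_0=\min\Big\{2\omega\Big(\frac{\lambda_B^2}{\gamma_R}\Big(1+\frac{\tilde\alpha_1}{\tilde\alpha_0}\Big)^2+\frac1{\gamma_Q\tilde\alpha_0^2}\Big)^{-1},\ \Big(\frac{\lambda_B^2}{2\gamma_R\omega}+\frac1{\gamma_Q}\Big)^{-1}\Big\}e^{-2\omega\sigma},$$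 $$c_1=\max\Big\{\Big(\Big(\lambda_Q+\frac{\lambda_H^2}{\gamma_R}\Big)\Big(1+\frac{\alpha_1'}{\alpha_0'}\Big)^2+\frac{\lambda_R\lambda_B^2}{(\alpha_0')^2}\Big)\frac1{2\omega},\ \Big(\lambda_Q+\frac{\lambda_H^2}{\gamma_R}\Big)\Big(1+\frac1{2\omega}\Big)\Big\}e^{2\omega\sigma}.$$ -/

import Mathlib

open scoped Matrix
-- `‖M‖` is the operator norm of the matrix `M` with respect to the Euclidean norms.
open scoped Matrix.Norms.L2Operator
-- `M ≤ N` is the Loewner order on matrices: `N - M` is symmetric positive semidefinite.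
open scoped MatrixOrder

namespace LQControl

/-! ### The evolution operator of a linear system -/

/-- The terms of the Peano-Baker series of `ẋ(t) = A(t) x(t)`: the zeroth one is the identity and
the `(k+1)`-st one is `∫ τ in s..t, A(τ) Pₖ(τ, s)`. -/
noncomputable def peanoBaker {n : ℕ} (A : ℝ → Matrix (Fin n) (Fin n) ℝ) :
    ℕ → ℝ → ℝ → Matrix (Fin n) (Fin n) ℝ
  | 0, _, _ => 1
  | k + 1, t, s => ∫ τ in s..t, A τ * peanoBaker A k τ s

/-- The evolution operator `Φ_A(t, s)` of the system `ẋ(t) = A(t) x(t)`, as the sum of the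
Peano-Baker series. Below it is shown that `t ↦ Φ_A(t, s)` is a solution of `Ẋ = A X`, `X(s) = I`,
and that `x(t) = Φ_A(t, s) x(s)` for each solution `x` of `ẋ = A x`. -/
noncomputable def evolutionOperator {n : ℕ} (A : ℝ → Matrix (Fin n) (Fin n) ℝ) (t s : ℝ) :
    Matrix (Fin n) (Fin n) ℝ :=
  ∑' k, peanoBaker A k t s

section Evolution

variable {n : ℕ}

theorem evolutionOperator_self (A : ℝ → Matrix (Fin n) (Fin n) ℝ) (s : ℝ) :
    evolutionOperator A s s = 1 := by
  unfold evolutionOperator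
  rw [tsum_eq_single 0]
  · rfl
  · intro k hk
    obtain ⟨k, rfl⟩ := Nat.exists_eq_succ_of_ne_zero hk
    simp [peanoBaker]

theorem peanoBaker_congr {A A' : ℝ → Matrix (Fin n) (Fin n) ℝ} {a b : ℝ}
    (h : Set.EqOn A A' (Set.Icc a b)) (k : ℕ) :
    ∀ t ∈ Set.Icc a b, ∀ s ∈ Set.Icc a b, peanoBaker A k t s = peanoBaker A' k t s := by
  induction k with
  | zero => intros; rfl
  | succ k ih =>
    intro t ht s hs
    simp only [peanoBaker]
    apply intervalIntegral.integral_congr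
    intro τ hτ
    have hτ' : τ ∈ Set.Icc a b := Set.uIcc_subset_Icc hs ht hτ
    simp only [h hτ', ih τ hτ' s hs]

theorem peanoBaker_continuous {A : ℝ → Matrix (Fin n) (Fin n) ℝ} (hA : Continuous A) (s : ℝ)
    (k : ℕ) : Continuous fun t => peanoBaker A k t s := by
  induction k with
  | zero => exact continuous_const
  | succ k ih =>
    have := fun t => ((hA.mul ih).integral_hasStrictDerivAt s t).hasDerivAt
    exact continuous_iff_continuousAt.2 fun t => (this t).continuousAt

theorem peanoBaker_hasDerivAt {A : ℝ → Matrix (Fin n) (Fin n) ℝ} (hA : Continuous A) (s t : ℝ)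
    (k : ℕ) : HasDerivAt (fun t => peanoBaker A (k + 1) t s) (A t * peanoBaker A k t s) t :=
  ((hA.mul (peanoBaker_continuous hA s k)).integral_hasStrictDerivAt s t).hasDerivAt

theorem peanoBaker_norm_le {A : ℝ → Matrix (Fin n) (Fin n) ℝ} {M : ℝ} (hM : ∀ t, ‖A t‖ ≤ M)
    (s : ℝ) (k : ℕ) : ∀ t, ‖peanoBaker A k t s‖ ≤
      ‖(1 : Matrix (Fin n) (Fin n) ℝ)‖ * (M ^ k * |t - s| ^ k / k.factorial) := by
  have hM0 : 0 ≤ M := (norm_nonneg _).trans (hM 0)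
  induction k with
  | zero => intro t; simp [peanoBaker]
  | succ k ih =>
    intro t
    simp only [peanoBaker]
    set c := ‖(1 : Matrix (Fin n) (Fin n) ℝ)‖
    refine (intervalIntegral.norm_integral_le_abs_of_norm_le
      (g := fun τ => (c * M ^ (k + 1) / k.factorial) * |τ - s| ^ k) ?_ ?_).trans ?_
    · refine Filter.Eventually.of_forall fun τ => ?_
      calc ‖A τ * peanoBaker A k τ s‖ ≤ ‖A τ‖ * ‖peanoBaker A k τ s‖ := norm_mul_le _ _
        _ ≤ M * (c * (M ^ k * |τ - s| ^ k / k.factorial)) :=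
            mul_le_mul (hM τ) (ih τ) (norm_nonneg _) hM0
        _ = _ := by ring
    · apply Continuous.intervalIntegrable
      fun_prop
    · rw [intervalIntegral.integral_const_mul, abs_mul, intervalIntegral.abs_intervalIntegral_eq,
        integral_pow_abs_sub_uIoc, abs_of_nonneg (a := c * M ^ (k + 1) / k.factorial)
          (by positivity), abs_of_nonneg (by positivity), Nat.factorial_succ]
      push_cast
      apply le_of_eq
      field_simp

theorem evolutionOperator_hasDerivAt {A : ℝ → Matrix (Fin n) (Fin n) ℝ} (hA : Continuous A)
    {M : ℝ} (hM : ∀ t, ‖A t‖ ≤ M) (s t : ℝ) :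
    HasDerivAt (fun t => evolutionOperator A t s) (A t * evolutionOperator A t s) t := by
  have hM0 : 0 ≤ M := (norm_nonneg _).trans (hM 0)
  set c := ‖(1 : Matrix (Fin n) (Fin n) ℝ)‖
  set r := |t - s| + 1
  have hsum : ∀ x : ℝ, Summable fun k : ℕ => c * (M ^ k * x ^ k / k.factorial) := fun x => by
    simpa [mul_pow] using (Real.summable_pow_div_factorial (M * x)).mul_left c
  have hP : ∀ u, Summable fun k => peanoBaker A k u s := fun u =>
    Summable.of_norm_bounded (hsum _) fun k => peanoBaker_norm_le hM s k u
  have hsplit : (fun t => evolutionOperator A t s) =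
      fun t => 1 + ∑' k, peanoBaker A (k + 1) t s := by
    funext u
    exact (hP u).tsum_eq_zero_add
  have hmul : A t * evolutionOperator A t s = ∑' k, A t * peanoBaker A k t s :=
    ((hP t).tsum_mul_left (A t)).symm
  rw [hsplit, hmul]
  refine HasDerivAt.const_add 1 ?_
  refine hasDerivAt_tsum_of_isPreconnected
    (u := fun k : ℕ => M * (c * (M ^ k * r ^ k / k.factorial)))
    (t := Metric.ball s r) ((hsum r).mul_left M) Metric.isOpen_ball
    (convex_ball s r).isPreconnected (fun k u _ => peanoBaker_hasDerivAt hA s u k) ?_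
    (y₀ := t) ?_ ((summable_nat_add_iff 1).2 (hP t)) ?_
  · intro k u hu
    have hu' : |u - s| ≤ r := by
      rw [Metric.mem_ball, Real.dist_eq] at hu
      exact hu.le
    refine (norm_mul_le _ _).trans (mul_le_mul (hM u) ((peanoBaker_norm_le hM s k u).trans ?_)
      (norm_nonneg _) hM0)
    gcongr
  all_goals
    rw [Metric.mem_ball, Real.dist_eq]
    exact lt_add_one _

/-- `t ↦ Φ_A(t, s)` solves the matrix differential equation `Ẋ = A X` on `[a, b]`. -/
theorem evolutionOperator_hasDerivWithinAt {A : ℝ → Matrix (Fin n) (Fin n) ℝ} {a b : ℝ}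
    (hA : ContinuousOn A (Set.Icc a b)) {s t : ℝ} (hs : s ∈ Set.Icc a b) (ht : t ∈ Set.Icc a b) :
    HasDerivWithinAt (fun t => evolutionOperator A t s) (A t * evolutionOperator A t s)
      (Set.Icc a b) t := by
  have hab : a ≤ b := hs.1.trans hs.2
  set A' : ℝ → Matrix (Fin n) (Fin n) ℝ := Set.IccExtend hab ((Set.Icc a b).domRestrict A) with hA'
  have hA'c : Continuous A' := (continuousOn_iff_continuous_domRestrict.1 hA).Icc_extend'
  have heq : Set.EqOn A A' (Set.Icc a b) := fun τ hτ => by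
    rw [hA', Set.IccExtend_of_mem hab _ hτ]; rfl
  obtain ⟨M, hM⟩ := isCompact_Icc.exists_bound_of_continuousOn hA
  have hM' : ∀ τ, ‖A' τ‖ ≤ M := fun τ => by
    exact hM _ (Set.projIcc a b hab τ).2
  have hΦ : ∀ u ∈ Set.Icc a b, evolutionOperator A u s = evolutionOperator A' u s := fun u hu =>
    tsum_congr fun k => peanoBaker_congr heq k u hu s hs
  rw [heq ht, hΦ t ht]
  exact (evolutionOperator_hasDerivAt hA'c hM' s t).hasDerivWithinAt.congr hΦ (hΦ t ht)

/-- Each solution of `ẋ = A x` on `[a, b]` satisfies `x(t) = Φ_A(t, s) x(s)`. -/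
theorem eq_evolutionOperator_mulVec {A : ℝ → Matrix (Fin n) (Fin n) ℝ} {a b : ℝ}
    (hA : ContinuousOn A (Set.Icc a b)) {x : ℝ → Fin n → ℝ}
    (hx : ∀ t ∈ Set.Icc a b, HasDerivWithinAt x (A t *ᵥ x t) (Set.Icc a b) t)
    {s t : ℝ} (hs : s ∈ Set.Icc a b) (ht : t ∈ Set.Icc a b) :
    x t = evolutionOperator A t s *ᵥ x s := by
  set L : Matrix (Fin n) (Fin n) ℝ →ₗ[ℝ] (Fin n → ℝ) →L[ℝ] (Fin n → ℝ) :=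
    { toFun := fun M => LinearMap.toContinuousLinearMap (Matrix.mulVecLin M)
      map_add' := fun M N => by ext; simp
      map_smul' := fun c M => by ext; simp } with hL
  have hLA : ContinuousOn (fun τ => L (A τ)) (Set.Icc a b) :=
    (LinearMap.continuous_of_finiteDimensional L).comp_continuousOn hA
  obtain ⟨K, hK⟩ := isCompact_Icc.exists_bound_of_continuousOn hLA
  have hv : ∀ τ ∈ Set.Icc a b,
      LipschitzOnWith K.toNNReal (fun y : Fin n → ℝ => A τ *ᵥ y) Set.univ := fun τ hτ => by
    refine ((L (A τ)).lipschitz.weaken ?_).lipschitzOnWith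
    exact NNReal.coe_le_coe.1 ((hK τ hτ).trans (Real.le_coe_toNNReal K))
  set y : ℝ → Fin n → ℝ := fun τ => evolutionOperator A τ s *ᵥ x s with hy
  have hyd : ∀ τ ∈ Set.Icc a b, HasDerivWithinAt y (A τ *ᵥ y τ) (Set.Icc a b) τ := by
    intro τ hτ
    let E : Matrix (Fin n) (Fin n) ℝ →L[ℝ] (Fin n → ℝ) :=
      LinearMap.toContinuousLinearMap ((LinearMap.applyₗ (x s)).comp
        (Matrix.toLin' (R := ℝ) (m := Fin n) (n := Fin n)).toLinearMap)
    have hE := E.hasFDerivAt.comp_hasDerivWithinAt τ (evolutionOperator_hasDerivWithinAt hA hs hτ)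
    have h1 : E (A τ * evolutionOperator A τ s) = A τ *ᵥ y τ := by
      simp [E, hy, Matrix.mulVec_mulVec]
    rw [h1] at hE
    exact hE.congr (fun u _ => by simp [E, hy]) (by simp [E, hy])
  have hxs : x s = y s := by simp [hy, evolutionOperator_self]
  rcases le_total s t with hst | hts
  · have hsub : Set.Icc s b ⊆ Set.Icc a b := Set.Icc_subset_Icc_left hs.1
    have key : ∀ z : ℝ → Fin n → ℝ,
        (∀ τ ∈ Set.Icc a b, HasDerivWithinAt z (A τ *ᵥ z τ) (Set.Icc a b) τ) →
        ∀ τ ∈ Set.Ico s b, HasDerivWithinAt z (A τ *ᵥ z τ) (Set.Ici τ) τ := fun z hz τ hτ =>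
      (hz τ (hsub (Set.Ico_subset_Icc_self hτ))).mono_of_mem_nhdsWithin
        (Filter.mem_of_superset (Icc_mem_nhdsGE hτ.2)
          (Set.Icc_subset_Icc_left (hs.1.trans hτ.1)))
    exact ODE_solution_unique_of_mem_Icc_right (s := fun _ => Set.univ)
      (fun τ hτ => hv τ (hsub (Set.Ico_subset_Icc_self hτ)))
      (fun τ hτ => ((hx τ (hsub hτ)).continuousWithinAt).mono hsub) (key x hx)
      (fun _ _ => trivial)
      (fun τ hτ => ((hyd τ (hsub hτ)).continuousWithinAt).mono hsub) (key y hyd)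
      (fun _ _ => trivial) hxs ⟨hst, ht.2⟩
  · have hsub : Set.Icc a s ⊆ Set.Icc a b := Set.Icc_subset_Icc_right hs.2
    have key : ∀ z : ℝ → Fin n → ℝ,
        (∀ τ ∈ Set.Icc a b, HasDerivWithinAt z (A τ *ᵥ z τ) (Set.Icc a b) τ) →
        ∀ τ ∈ Set.Ioc a s, HasDerivWithinAt z (A τ *ᵥ z τ) (Set.Iic τ) τ := fun z hz τ hτ =>
      (hz τ (hsub (Set.Ioc_subset_Icc_self hτ))).mono_of_mem_nhdsWithin
        (Filter.mem_of_superset (Icc_mem_nhdsLE hτ.1)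
          (Set.Icc_subset_Icc_right (hτ.2.trans hs.2)))
    exact ODE_solution_unique_of_mem_Icc_left (s := fun _ => Set.univ)
      (fun τ hτ => hv τ (hsub (Set.Ioc_subset_Icc_self hτ)))
      (fun τ hτ => ((hx τ (hsub hτ)).continuousWithinAt).mono hsub) (key x hx)
      (fun _ _ => trivial)
      (fun τ hτ => ((hyd τ (hsub hτ)).continuousWithinAt).mono hsub) (key y hyd)
      (fun _ _ => trivial) hxs ⟨ht.1, hts⟩

end Evolution

/-- The controllability Gramian
`W_{A,B}(t₀, t₁) = ∫ s in t₀..t₁, Φ_A(t₀, s) B(s) B(s)ᵀ Φ_A(t₀, s)ᵀ`. -/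
noncomputable def gramian {nx nu : ℕ} (A : ℝ → Matrix (Fin nx) (Fin nx) ℝ)
    (B : ℝ → Matrix (Fin nx) (Fin nu) ℝ) (t₀ t₁ : ℝ) : Matrix (Fin nx) (Fin nx) ℝ :=
  ∫ s in t₀..t₁, evolutionOperator A t₀ s * B s * (B s)ᵀ * (evolutionOperator A t₀ s)ᵀ

/-! ### The data and the assumptions -/

/-- The data of a linear-quadratic optimal control problem on `[0, T]`: dynamics
`ẋ = A x + B u`, running cost `½ (xᵀ Q x + 2 uᵀ H x + uᵀ R u)`, terminal cost `½ x(T)ᵀ Q_T x(T)`.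
Only the values of the coefficients on `[0, T]` matter. -/
structure Problem (nx nu : ℕ) where
  T : ℝ
  A : ℝ → Matrix (Fin nx) (Fin nx) ℝ
  B : ℝ → Matrix (Fin nx) (Fin nu) ℝ
  Q : ℝ → Matrix (Fin nx) (Fin nx) ℝ
  H : ℝ → Matrix (Fin nu) (Fin nx) ℝ
  R : ℝ → Matrix (Fin nu) (Fin nu) ℝ
  QT : Matrix (Fin nx) (Fin nx) ℝ

/-- The constants of the assumptions; they involve neither the horizon `T` nor the data. -/
structure Constants where
  lamA : ℝ
  lamB : ℝ
  lamQ : ℝ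
  lamH : ℝ
  lamR : ℝ
  γR : ℝ
  γQ : ℝ
  σ : ℝ
  α₀ : ℝ
  α₁ : ℝ
  β₀ : ℝ
  β₁ : ℝ

namespace Problem

variable {nx nu : ℕ} (P : Problem nx nu) (k : Constants)

/-- Continuity and uniform boundedness of the coefficients. -/
structure IsBounded : Prop where
  lamA_pos : 0 < k.lamA
  lamB_pos : 0 < k.lamB
  lamQ_pos : 0 < k.lamQ
  lamH_pos : 0 < k.lamH
  lamR_pos : 0 < k.lamR
  continuousOn_A : ContinuousOn P.A (Set.Icc 0 P.T)
  continuousOn_B : ContinuousOn P.B (Set.Icc 0 P.T)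
  continuousOn_Q : ContinuousOn P.Q (Set.Icc 0 P.T)
  continuousOn_H : ContinuousOn P.H (Set.Icc 0 P.T)
  continuousOn_R : ContinuousOn P.R (Set.Icc 0 P.T)
  norm_A_le : ∀ t ∈ Set.Icc 0 P.T, ‖P.A t‖ ≤ k.lamA
  norm_B_le : ∀ t ∈ Set.Icc 0 P.T, ‖P.B t‖ ≤ k.lamB
  norm_Q_le : ∀ t ∈ Set.Icc 0 P.T, ‖P.Q t‖ ≤ k.lamQ
  norm_H_le : ∀ t ∈ Set.Icc 0 P.T, ‖P.H t‖ ≤ k.lamH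
  norm_R_le : ∀ t ∈ Set.Icc 0 P.T, ‖P.R t‖ ≤ k.lamR

/-- Uniform complete controllability of the pair `(A, B)`. -/
structure IsUCC : Prop where
  σ_pos : 0 < k.σ
  σ_lt : k.σ < P.T
  α₀_pos : 0 < k.α₀
  α₁_pos : 0 < k.α₁
  β₀_pos : 0 < k.β₀
  β₁_pos : 0 < k.β₁
  bounds : ∀ t₀ ∈ Set.Icc 0 (P.T - k.σ), ∃ t₁ ∈ Set.Icc t₀ (t₀ + k.σ),
    k.α₀ • 1 ≤ gramian P.A P.B t₀ t₁ ∧ gramian P.A P.B t₀ t₁ ≤ k.α₁ • 1 ∧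
    k.β₀ • 1 ≤ evolutionOperator P.A t₁ t₀ * gramian P.A P.B t₀ t₁ *
      (evolutionOperator P.A t₁ t₀)ᵀ ∧
    evolutionOperator P.A t₁ t₀ * gramian P.A P.B t₀ t₁ *
      (evolutionOperator P.A t₁ t₀)ᵀ ≤ k.β₁ • 1

/-- Coercivity of the cost. The weights `Q(t)`, `R(t)`, `Q_T` are symmetric matrices. -/
structure IsCoercive : Prop where
  γR_pos : 0 < k.γR
  γQ_pos : 0 < k.γQ
  γQ_le : k.γQ ≤ k.lamQ
  symm_Q : ∀ t ∈ Set.Icc 0 P.T, (P.Q t).IsSymm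
  symm_R : ∀ t ∈ Set.Icc 0 P.T, (P.R t).IsSymm
  symm_QT : P.QT.IsSymm
  le_R : ∀ t ∈ Set.Icc 0 P.T, k.γR • 1 ≤ P.R t
  le_Q : ∀ t ∈ Set.Icc 0 P.T, k.γQ • 1 ≤ P.Q t - (P.H t)ᵀ * (P.R t)⁻¹ * P.H t
  le_QT : k.γQ • 1 ≤ P.QT
  QT_le : P.QT ≤ k.lamQ • 1

/-! ### The Riccati equation and the closed-loop matrix -/

/-- `S` solves the terminal value problem for the matrix Riccati equation on `[0, T]`
(with one-sided derivatives at the end points). -/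
structure IsRiccatiSolution (S : ℝ → Matrix (Fin nx) (Fin nx) ℝ) : Prop where
  hasDerivWithinAt : ∀ t ∈ Set.Icc 0 P.T, HasDerivWithinAt S
    (S t * P.B t * (P.R t)⁻¹ * (P.B t)ᵀ * S t
      - S t * (P.A t - P.B t * (P.R t)⁻¹ * P.H t)
      - (P.A t - P.B t * (P.R t)⁻¹ * P.H t)ᵀ * S t
      - (P.Q t - (P.H t)ᵀ * (P.R t)⁻¹ * P.H t)) (Set.Icc 0 P.T) t
  terminal : S P.T = P.QT

/-- The closed-loop matrix `Z = A - B R⁻¹ H - B R⁻¹ Bᵀ S`. -/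
noncomputable def closedLoop (S : ℝ → Matrix (Fin nx) (Fin nx) ℝ) (t : ℝ) :
    Matrix (Fin nx) (Fin nx) ℝ :=
  P.A t - P.B t * (P.R t)⁻¹ * P.H t - P.B t * (P.R t)⁻¹ * (P.B t)ᵀ * S t

end Problem

/-! ### The explicit constants -/

namespace Constants

variable (k : Constants)

/-- `ω = λ_A + λ_B λ_H / γ_R`, a bound for `‖A - B R⁻¹ H‖`. -/
noncomputable def ω : ℝ := k.lamA + k.lamB * k.lamH / k.γR

/-- The lower constant `α₀'` for the Gramian of `(A - B R⁻¹ H, B)`. -/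
noncomputable def α₀' : ℝ :=
  (2 / k.α₀ + (k.lamH / k.γR) ^ 2 / k.lamA * (1 + k.α₁ / k.α₀) ^ 2 *
    (Real.exp (2 * k.lamA * k.σ) - 1))⁻¹

/-- The upper constant `α₁'` for the Gramian of `(A - B R⁻¹ H, B)`. -/
noncomputable def α₁' : ℝ :=
  k.lamB ^ 2 * (Real.exp (2 * k.σ * k.ω) - 1) / (2 * k.ω)

/-- The lower constant for the Gramian of the dual pair `(-(A - B R⁻¹ H)ᵀ, I)`. -/
noncomputable def αt₀ : ℝ := 1 / (2 * k.ω) * (1 - Real.exp (-2 * k.ω * k.σ))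

/-- The upper constant for the Gramian of the dual pair `(-(A - B R⁻¹ H)ᵀ, I)`. -/
noncomputable def αt₁ : ℝ := 1 / (2 * k.ω) * (Real.exp (2 * k.ω * k.σ) - 1)

/-- The lower Riccati constant `c₀(σ)`. -/
noncomputable def c₀ : ℝ :=
  min (2 * k.ω * (k.lamB ^ 2 / k.γR * (1 + k.αt₁ / k.αt₀) ^ 2 + 1 / (k.γQ * k.αt₀ ^ 2))⁻¹)
      ((k.lamB ^ 2 / (2 * k.γR * k.ω) + 1 / k.γQ)⁻¹) *
    Real.exp (-2 * k.ω * k.σ)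

/-- The upper Riccati constant `c₁(σ)`. -/
noncomputable def c₁ : ℝ :=
  max (((k.lamQ + k.lamH ^ 2 / k.γR) * (1 + k.α₁' / k.α₀') ^ 2 +
        k.lamR * k.lamB ^ 2 / k.α₀' ^ 2) * (1 / (2 * k.ω)))
      ((k.lamQ + k.lamH ^ 2 / k.γR) * (1 + 1 / (2 * k.ω))) *
    Real.exp (2 * k.ω * k.σ)

end Constants

end LQControl

/-!
Write `F = A - B R⁻¹ H`, `G = B R⁻¹ Bᵀ` and let `S` solve the Riccati equation. It exists on all of
`[0, T]`: if `X, Y` solve the linear Hamiltonian system from `(I, Q_T)` at time `T`, then `X` never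
becomes singular and `S = Y X⁻¹`.

The difference of two Riccati solutions solves a Lyapunov equation, so solutions are ordered as soon
as their weights and terminal values are. Comparison with the constant `c₀ I` gives `c₀ I ≤ S`, and
comparison with a growing exponential gives `S ≤ c₁ I` on the last interval `[T - σ, T]`. For
`t ≤ T - σ`, `v ⬝ S(t) v` is at most the cost of any control plus the terminal cost given by `S`;
the minimum energy control that steers `v` to `0` within time `σ` has cost at most `c₁ |v|²`.

Along `ẋ = Z x` the function `x ⬝ S x` decreases at rate at least `γ_Q |x|² ≥ (γ_Q / c₁) x ⬝ S x`,
and it lies between `c₀ |x|²` and `c₁ |x|²`.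
-/

namespace LQControl

section QuadraticForms

variable {m n : Type*} [Fintype m] [Fintype n]

theorem dotProduct_self_eq_norm_sq (x : n → ℝ) : x ⬝ᵥ x = ‖WithLp.toLp 2 x‖ ^ 2 := by
  rw [EuclideanSpace.real_norm_sq_eq]
  exact Finset.sum_congr rfl fun i _ => (sq (x i)).symm

theorem dotProduct_self_nonneg (x : n → ℝ) : 0 ≤ x ⬝ᵥ x := by
  simpa only [star_trivial] using dotProduct_self_star_nonneg x

theorem dotProduct_add_self_le (x y : n → ℝ) :
    (x + y) ⬝ᵥ (x + y) ≤ 2 * (x ⬝ᵥ x) + 2 * (y ⬝ᵥ y) := by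
  have h := dotProduct_self_nonneg (x - y)
  simp only [sub_dotProduct, dotProduct_sub, dotProduct_comm y x] at h
  simp only [add_dotProduct, dotProduct_add, dotProduct_comm y x]
  linarith

theorem mulVec_dotProduct_mulVec (M : Matrix m n ℝ) (N : Matrix m m ℝ) (x : n → ℝ) :
    (M *ᵥ x) ⬝ᵥ (N *ᵥ (M *ᵥ x)) = x ⬝ᵥ ((Mᵀ * N * M) *ᵥ x) := by
  rw [← Matrix.mulVec_mulVec, ← Matrix.mulVec_mulVec, Matrix.dotProduct_transpose_mulVec,
    dotProduct_comm]

theorem isSymm_dotProduct_mulVec_comm {M : Matrix n n ℝ} (hM : M.IsSymm) (x y : n → ℝ) :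
    x ⬝ᵥ (M *ᵥ y) = y ⬝ᵥ (M *ᵥ x) := by
  rw [← Matrix.dotProduct_transpose_mulVec, hM.eq]

variable [DecidableEq n]

theorem mulVec_dotProduct_self_le {M : Matrix m n ℝ} {c : ℝ} (h : ‖M‖ ≤ c) (x : n → ℝ) :
    (M *ᵥ x) ⬝ᵥ (M *ᵥ x) ≤ c ^ 2 * (x ⬝ᵥ x) := by
  rw [dotProduct_self_eq_norm_sq, dotProduct_self_eq_norm_sq, ← mul_pow]
  exact pow_le_pow_left₀ (norm_nonneg _) ((Matrix.l2_opNorm_mulVec M (WithLp.toLp 2 x)).trans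
    (mul_le_mul_of_nonneg_right h (norm_nonneg _))) 2

theorem norm_le_of_mulVec_dotProduct_self_le {M : Matrix m n ℝ} {c : ℝ} (hc : 0 ≤ c)
    (h : ∀ x, (M *ᵥ x) ⬝ᵥ (M *ᵥ x) ≤ c ^ 2 * (x ⬝ᵥ x)) : ‖M‖ ≤ c := by
  rw [Matrix.l2_opNorm_def]
  refine ContinuousLinearMap.opNorm_le_bound _ hc fun x => le_of_sq_le_sq ?_ (by positivity)
  have hx := h (WithLp.ofLp x)
  rwa [dotProduct_self_eq_norm_sq, dotProduct_self_eq_norm_sq, ← mul_pow] at hx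

theorem abs_dotProduct_mulVec_le {M : Matrix n n ℝ} {c : ℝ} (h : ‖M‖ ≤ c) (x : n → ℝ) :
    |x ⬝ᵥ (M *ᵥ x)| ≤ c * (x ⬝ᵥ x) := by
  have hc : 0 ≤ c := (norm_nonneg M).trans h
  refine abs_le_of_sq_le_sq ?_ (mul_nonneg hc (dotProduct_self_nonneg x))
  calc (x ⬝ᵥ (M *ᵥ x)) ^ 2
      ≤ (x ⬝ᵥ x) * ((M *ᵥ x) ⬝ᵥ (M *ᵥ x)) := by
        simpa only [dotProduct, sq] using Finset.sum_mul_sq_le_sq_mul_sq Finset.univ x (M *ᵥ x)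
    _ ≤ (x ⬝ᵥ x) * (c ^ 2 * (x ⬝ᵥ x)) :=
        mul_le_mul_of_nonneg_left (mulVec_dotProduct_self_le h x) (dotProduct_self_nonneg x)
    _ = (c * (x ⬝ᵥ x)) ^ 2 := by ring

theorem norm_one_le : ‖(1 : Matrix n n ℝ)‖ ≤ 1 :=
  norm_le_of_mulVec_dotProduct_self_le zero_le_one fun x => by simp

theorem norm_transpose [DecidableEq m] (M : Matrix m n ℝ) : ‖Mᵀ‖ = ‖M‖ := by
  rw [← Matrix.conjTranspose_eq_transpose_of_trivial, Matrix.l2_opNorm_conjTranspose]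

end QuadraticForms

section LoewnerOrder

variable {n : Type*} [Fintype n]

theorem le_iff_isSymm_dotProduct {M N : Matrix n n ℝ} :
    M ≤ N ↔ (N - M).IsSymm ∧ ∀ x, x ⬝ᵥ (M *ᵥ x) ≤ x ⬝ᵥ (N *ᵥ x) := by
  rw [Matrix.le_iff, Matrix.posSemidef_iff_dotProduct_mulVec, Matrix.IsHermitian, Matrix.IsSymm,
    Matrix.conjTranspose_eq_transpose_of_trivial]
  simp [Matrix.sub_mulVec]

theorem isSymm_of_nonneg {n : Type*} [Finite n] {M : Matrix n n ℝ} (h : 0 ≤ M) : M.IsSymm := by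
  cases nonempty_fintype n
  simpa only [sub_zero] using (le_iff_isSymm_dotProduct.1 h).1

theorem dotProduct_mulVec_nonneg {M : Matrix n n ℝ} (h : 0 ≤ M) (x : n → ℝ) :
    0 ≤ x ⬝ᵥ (M *ᵥ x) := by
  simpa only [Matrix.zero_mulVec, dotProduct_zero] using (le_iff_isSymm_dotProduct.1 h).2 x

theorem nonneg_mul_mul_transpose {m : Type*} [Finite m] {M : Matrix n n ℝ} (h : 0 ≤ M)
    (N : Matrix m n ℝ) : 0 ≤ N * M * Nᵀ := by
  simpa only [Matrix.conjTranspose_eq_transpose_of_trivial] using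
    ((Matrix.nonneg_iff_posSemidef.1 h).mul_mul_conjTranspose_same N).nonneg

theorem posDef_of_smul_one_le {n : Type*} [DecidableEq n] {M : Matrix n n ℝ} {c : ℝ} (hc : 0 < c)
    (h : c • 1 ≤ M) : M.PosDef := by
  have := (Matrix.PosDef.one.smul hc).add_posSemidef (Matrix.le_iff.1 h)
  rwa [add_sub_cancel] at this

variable [DecidableEq n] {M : Matrix n n ℝ} {c : ℝ}

theorem smul_one_le_iff : c • 1 ≤ M ↔ M.IsSymm ∧ ∀ x, c * (x ⬝ᵥ x) ≤ x ⬝ᵥ (M *ᵥ x) := by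
  rw [le_iff_isSymm_dotProduct]
  simp [Matrix.IsSymm, Matrix.smul_mulVec]

theorem le_smul_one_iff : M ≤ c • 1 ↔ M.IsSymm ∧ ∀ x, x ⬝ᵥ (M *ᵥ x) ≤ c * (x ⬝ᵥ x) := by
  rw [le_iff_isSymm_dotProduct]
  simp [Matrix.IsSymm, Matrix.smul_mulVec]

theorem le_smul_one_of_norm_le (hM : M.IsSymm) (h : ‖M‖ ≤ c) : M ≤ c • 1 :=
  le_smul_one_iff.2 ⟨hM, fun x => (le_abs_self _).trans (abs_dotProduct_mulVec_le h x)⟩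

theorem smul_one_le_smul_one {n : Type*} [Finite n] [DecidableEq n] {c d : ℝ} (h : c ≤ d) :
    c • (1 : Matrix n n ℝ) ≤ d • 1 := by
  cases nonempty_fintype n
  exact smul_one_le_iff.2 ⟨by simp [Matrix.IsSymm], fun x => by
    simpa [Matrix.smul_mulVec] using mul_le_mul_of_nonneg_right h (dotProduct_self_nonneg x)⟩

theorem le_of_smul_one_le_smul_one {n : Type*} [Finite n] [Nonempty n] [DecidableEq n] {c d : ℝ}
    (h : c • (1 : Matrix n n ℝ) ≤ d • 1) : c ≤ d := by
  cases nonempty_fintype n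
  obtain ⟨i⟩ := ‹Nonempty n›
  simpa [Matrix.smul_mulVec] using (smul_one_le_iff.1 h).2 (Pi.single i 1)

theorem norm_le_of_nonneg_of_le_smul_one (hc : 0 < c) (h₀ : 0 ≤ M) (h₁ : M ≤ c • 1) :
    ‖M‖ ≤ c := by
  refine norm_le_of_mulVec_dotProduct_self_le hc.le fun x => ?_
  have hform := (le_smul_one_iff.1 h₁).2
  -- Nonnegativity at `c x - M x` gives `c |M x|² ≤ c² x ⬝ M x`.
  have htest := dotProduct_mulVec_nonneg h₀ (c • x - M *ᵥ x)
  simp only [Matrix.mulVec_sub, Matrix.mulVec_smul, sub_dotProduct, dotProduct_sub,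
    smul_dotProduct, dotProduct_smul, smul_eq_mul,
    isSymm_dotProduct_mulVec_comm (isSymm_of_nonneg h₀) x (M *ᵥ x)] at htest
  have hsq : (M *ᵥ x) ⬝ᵥ (M *ᵥ x) ≤ c * (x ⬝ᵥ (M *ᵥ x)) :=
    le_of_mul_le_mul_left (by linarith [hform (M *ᵥ x)]) hc
  calc (M *ᵥ x) ⬝ᵥ (M *ᵥ x) ≤ c * (x ⬝ᵥ (M *ᵥ x)) := hsq
    _ ≤ c * (c * (x ⬝ᵥ x)) := mul_le_mul_of_nonneg_left (hform x) hc.le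
    _ = c ^ 2 * (x ⬝ᵥ x) := by ring

theorem inv_nonneg_of_smul_one_le (hc : 0 < c) (h : c • 1 ≤ M) : 0 ≤ M⁻¹ :=
  (posDef_of_smul_one_le hc h).inv.posSemidef.nonneg

theorem norm_inv_le_of_smul_one_le (hc : 0 < c) (h : c • 1 ≤ M) : ‖M⁻¹‖ ≤ 1 / c := by
  have hunit : IsUnit M.det :=
    (Matrix.isUnit_iff_isUnit_det M).1 (posDef_of_smul_one_le hc h).isUnit
  refine norm_le_of_mulVec_dotProduct_self_le (by positivity) fun x => ?_
  set y := M⁻¹ *ᵥ x with hy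
  have hMy : M *ᵥ y = x := by
    rw [hy, Matrix.mulVec_mulVec, Matrix.mul_nonsing_inv _ hunit, Matrix.one_mulVec]
  have hcoer := (smul_one_le_iff.1 h).2 y
  have hsq := dotProduct_self_nonneg (x - c • y)
  rw [hMy] at hcoer
  simp only [sub_dotProduct, dotProduct_sub, smul_dotProduct, dotProduct_smul, smul_eq_mul,
    dotProduct_comm x y] at hsq
  rw [one_div, inv_pow, inv_mul_eq_div, le_div_iff₀ (by positivity)]
  nlinarith

end LoewnerOrder

section MatrixCalculus

variable {X l m n : Type*}

theorem continuousOn_matrix_mul [TopologicalSpace X] [Fintype m] {s : Set X} {M : X → Matrix l m ℝ}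
    {N : X → Matrix m n ℝ} (hM : ContinuousOn M s) (hN : ContinuousOn N s) :
    ContinuousOn (fun x => M x * N x) s :=
  (continuous_fst.matrix_mul continuous_snd).comp_continuousOn (hM.prodMk hN)

theorem continuousOn_matrix_transpose [TopologicalSpace X] {s : Set X}
    {M : X → Matrix m n ℝ} (hM : ContinuousOn M s) : ContinuousOn (fun x => (M x)ᵀ) s :=
  continuous_id.matrix_transpose.comp_continuousOn hM

theorem continuousOn_matrix_inv [TopologicalSpace X] [Fintype n] [DecidableEq n] {s : Set X}
    {M : X → Matrix n n ℝ} (hM : ContinuousOn M s) (hunit : ∀ x ∈ s, IsUnit (M x)) :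
    ContinuousOn (fun x => (M x)⁻¹) s := by
  intro x hx
  obtain ⟨u, hu⟩ := hunit x hx
  have hinv := NormedRing.inverse_continuousAt u
  rw [hu] at hinv
  simp only [Matrix.nonsing_inv_eq_ringInverse]
  exact ContinuousAt.comp_continuousWithinAt (f := M) hinv (hM x hx)

variable {s : Set ℝ} {t : ℝ} {M : ℝ → Matrix m n ℝ} {M' : Matrix m n ℝ}

theorem hasDerivWithinAt_matrix_iff [Finite m] [Finite n] :
    HasDerivWithinAt M M' s t ↔ ∀ i j, HasDerivWithinAt (fun τ => M τ i j) (M' i j) s t := by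
  classical
  cases nonempty_fintype m
  cases nonempty_fintype n
  let e : Matrix m n ℝ ≃L[ℝ] (m → n → ℝ) :=
    LinearEquiv.toContinuousLinearEquiv (Matrix.ofLinearEquiv ℝ).symm
  have he : HasDerivWithinAt M M' s t ↔ HasDerivWithinAt (fun τ => e (M τ)) (e M') s t :=
    ⟨fun h => e.hasFDerivAt.comp_hasDerivWithinAt t h,
      fun h => e.symm.hasFDerivAt.comp_hasDerivWithinAt t h⟩
  rw [he]
  simp only [hasDerivWithinAt_pi]
  rfl

theorem hasDerivWithinAt_matrix_transpose [Finite m] [Finite n]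
    (hM : HasDerivWithinAt M M' s t) : HasDerivWithinAt (fun τ => (M τ)ᵀ) M'ᵀ s t :=
  hasDerivWithinAt_matrix_iff.2 fun i j => hasDerivWithinAt_matrix_iff.1 hM j i

theorem hasDerivWithinAt_matrix_mul [Finite l] [Fintype m] [Finite n]
    {L : ℝ → Matrix l m ℝ} {L' : Matrix l m ℝ} (hL : HasDerivWithinAt L L' s t)
    (hM : HasDerivWithinAt M M' s t) :
    HasDerivWithinAt (fun τ => L τ * M τ) (L' * M t + L t * M') s t := by
  rw [hasDerivWithinAt_matrix_iff] at *
  intro i j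
  simp only [Matrix.mul_apply, Matrix.add_apply, ← Finset.sum_add_distrib]
  exact HasDerivWithinAt.fun_sum fun k _ => (hL i k).mul (hM k j)

theorem hasDerivWithinAt_matrix_inv [Fintype n] [DecidableEq n] {N : ℝ → Matrix n n ℝ}
    {N' : Matrix n n ℝ}
    (hN : HasDerivWithinAt N N' s t) (hunit : IsUnit (N t)) :
    HasDerivWithinAt (fun τ => (N τ)⁻¹) (-((N t)⁻¹ * N' * (N t)⁻¹)) s t := by
  obtain ⟨u, hu⟩ := hunit
  have hinv := hasFDerivAt_ringInverse (𝕜 := ℝ) u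
  rw [hu] at hinv
  simp only [Matrix.nonsing_inv_eq_ringInverse]
  refine (hinv.comp_hasDerivWithinAt t hN).congr_deriv ?_
  rw [← hu, Ring.inverse_unit]
  simp

theorem hasDerivWithinAt_dotProduct [Fintype m] {x y : ℝ → m → ℝ} {x' y' : m → ℝ}
    (hx : HasDerivWithinAt x x' s t) (hy : HasDerivWithinAt y y' s t) :
    HasDerivWithinAt (fun τ => x τ ⬝ᵥ y τ) (x' ⬝ᵥ y t + x t ⬝ᵥ y') s t := by
  rw [hasDerivWithinAt_pi] at *
  simp only [dotProduct, ← Finset.sum_add_distrib]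
  exact HasDerivWithinAt.fun_sum fun k _ => (hx k).mul (hy k)

theorem hasDerivWithinAt_mulVec [Finite m] [Fintype n] {x : ℝ → n → ℝ} {x' : n → ℝ}
    (hM : HasDerivWithinAt M M' s t) (hx : HasDerivWithinAt x x' s t) :
    HasDerivWithinAt (fun τ => M τ *ᵥ x τ) (M' *ᵥ x t + M t *ᵥ x') s t := by
  cases nonempty_fintype m
  exact hasDerivWithinAt_pi.2 fun i => hasDerivWithinAt_dotProduct
    (hasDerivWithinAt_pi.2 (hasDerivWithinAt_matrix_iff.1 hM i)) hx

theorem hasDerivWithinAt_mulVec_const [Finite m] [Fintype n] (hM : HasDerivWithinAt M M' s t)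
    (x : n → ℝ) :
    HasDerivWithinAt (fun τ => M τ *ᵥ x) (M' *ᵥ x) s t := by
  simpa using hasDerivWithinAt_mulVec hM (hasDerivWithinAt_const t s x)

end MatrixCalculus

section Comparison

variable {a b : ℝ}

theorem le_of_hasDerivWithinAt_nonneg {f f' : ℝ → ℝ} (hab : a ≤ b)
    (hf : ∀ t ∈ Set.Icc a b, HasDerivWithinAt f (f' t) (Set.Icc a b) t)
    (h : ∀ t ∈ Set.Icc a b, 0 ≤ f' t) : f a ≤ f b :=
  monotoneOn_of_hasDerivWithinAt_nonneg (convex_Icc a b)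
    (fun t ht => (hf t ht).continuousWithinAt)
    (fun t ht => (hf t (interior_subset ht)).mono interior_subset)
    (fun t ht => h t (interior_subset ht)) (Set.left_mem_Icc.2 hab) (Set.right_mem_Icc.2 hab) hab

theorem hasDerivWithinAt_exp_mul_sub (c t₀ : ℝ) {s : Set ℝ} {t : ℝ} :
    HasDerivWithinAt (fun τ => Real.exp (c * (τ - t₀))) (c * Real.exp (c * (t - t₀))) s t := by
  have h : HasDerivAt (fun τ => c * (τ - t₀)) c t := by
    simpa using ((hasDerivAt_id t).sub_const t₀).const_mul c
  exact (h.exp.congr_deriv (by ring)).hasDerivWithinAt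

theorem exp_mul_le_of_mul_le_deriv {f f' : ℝ → ℝ} {c : ℝ} (hab : a ≤ b)
    (hf : ∀ t ∈ Set.Icc a b, HasDerivWithinAt f (f' t) (Set.Icc a b) t)
    (h : ∀ t ∈ Set.Icc a b, c * f t ≤ f' t) : Real.exp (c * (b - a)) * f a ≤ f b := by
  have hmono := le_of_hasDerivWithinAt_nonneg hab
    (fun t ht => (hasDerivWithinAt_exp_mul_sub (-c) a).mul (hf t ht)) fun t ht => by
      linarith [mul_le_mul_of_nonneg_left (h t ht) (Real.exp_pos (-c * (t - a))).le]
  simp only [Pi.mul_apply, sub_self, mul_zero, Real.exp_zero, one_mul] at hmono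
  calc Real.exp (c * (b - a)) * f a
      ≤ Real.exp (c * (b - a)) * (Real.exp (-c * (b - a)) * f b) :=
        mul_le_mul_of_nonneg_left hmono (Real.exp_pos _).le
    _ = f b := by rw [← mul_assoc, ← Real.exp_add, neg_mul, add_neg_cancel, Real.exp_zero, one_mul]

theorem le_exp_mul_of_deriv_le_mul {f f' : ℝ → ℝ} {c : ℝ} (hab : a ≤ b)
    (hf : ∀ t ∈ Set.Icc a b, HasDerivWithinAt f (f' t) (Set.Icc a b) t)
    (h : ∀ t ∈ Set.Icc a b, f' t ≤ c * f t) : f b ≤ Real.exp (c * (b - a)) * f a := by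
  have hneg := exp_mul_le_of_mul_le_deriv (f := fun t => -f t) (c := c) hab
    (fun t ht => (hf t ht).neg) fun t ht => by linarith [h t ht]
  linarith

theorem matrix_le_of_hasDerivWithinAt_nonneg {n : Type*} [Finite n]
    {M M' : ℝ → Matrix n n ℝ} (hab : a ≤ b)
    (hM : ∀ t ∈ Set.Icc a b, HasDerivWithinAt M (M' t) (Set.Icc a b) t)
    (h : ∀ t ∈ Set.Icc a b, 0 ≤ M' t) : M a ≤ M b := by
  classical
  cases nonempty_fintype n
  refine le_iff_isSymm_dotProduct.2 ⟨?_, fun x => ?_⟩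
  · have hskew : ∀ t ∈ Set.Icc a b,
        HasDerivWithinAt (fun τ => (M τ)ᵀ - M τ) 0 (Set.Icc a b) t := fun t ht => by
      have := (hasDerivWithinAt_matrix_transpose (hM t ht)).sub (hM t ht)
      rwa [(isSymm_of_nonneg (h t ht)).eq, sub_self] at this
    have hconst := constant_of_derivWithin_zero (fun t ht => (hskew t ht).differentiableWithinAt)
      (fun t ht => (hskew t (Set.Ico_subset_Icc_self ht)).derivWithin
        (uniqueDiffOn_Icc (ht.1.trans_lt ht.2) t (Set.Ico_subset_Icc_self ht)))
      b (Set.right_mem_Icc.2 hab)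
    rw [Matrix.IsSymm, Matrix.transpose_sub, ← sub_eq_zero]
    rw [← sub_eq_zero] at hconst
    rw [← hconst]
    abel
  · exact le_of_hasDerivWithinAt_nonneg hab
      (fun t ht => hasDerivWithinAt_dotProduct (hasDerivWithinAt_const t _ x)
        (hasDerivWithinAt_mulVec_const (hM t ht) x))
      fun t ht => by simpa using dotProduct_mulVec_nonneg (h t ht) x

end Comparison

section EvolutionOperator

variable {n : ℕ} {a b : ℝ} {A : ℝ → Matrix (Fin n) (Fin n) ℝ}

theorem evolutionOperator_mulVec_hasDerivWithinAt (hA : ContinuousOn A (Set.Icc a b)) {s t : ℝ}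
    (hs : s ∈ Set.Icc a b) (ht : t ∈ Set.Icc a b) (v : Fin n → ℝ) :
    HasDerivWithinAt (fun τ => evolutionOperator A τ s *ᵥ v)
      (A t *ᵥ (evolutionOperator A t s *ᵥ v)) (Set.Icc a b) t := by
  rw [Matrix.mulVec_mulVec]
  exact hasDerivWithinAt_mulVec_const (evolutionOperator_hasDerivWithinAt hA hs ht) v

theorem evolutionOperator_mul_swap (hA : ContinuousOn A (Set.Icc a b)) {s t : ℝ}
    (hs : s ∈ Set.Icc a b) (ht : t ∈ Set.Icc a b) :
    evolutionOperator A t s * evolutionOperator A s t = 1 := by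
  refine Matrix.mulVec_injective (funext fun v => ?_)
  rw [← Matrix.mulVec_mulVec, ← eq_evolutionOperator_mulVec hA
    (fun τ hτ => evolutionOperator_mulVec_hasDerivWithinAt hA ht hτ v) hs ht,
    evolutionOperator_self]

theorem continuousOn_evolutionOperator_right (hA : ContinuousOn A (Set.Icc a b)) {s : ℝ}
    (hs : s ∈ Set.Icc a b) : ContinuousOn (fun t => evolutionOperator A s t) (Set.Icc a b) := by
  have hunit : ∀ t ∈ Set.Icc a b, IsUnit (evolutionOperator A t s) := fun t ht =>
    (Matrix.isUnit_iff_isUnit_det _).2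
      (Matrix.isUnit_det_of_right_inverse (evolutionOperator_mul_swap hA hs ht))
  refine (continuousOn_matrix_inv (fun t ht =>
    (evolutionOperator_hasDerivWithinAt hA hs ht).continuousWithinAt) hunit).congr fun t ht => ?_
  exact (Matrix.inv_eq_left_inv (evolutionOperator_mul_swap hA ht hs)).symm

theorem hasDerivWithinAt_dotProduct_self_trajectory {x : ℝ → Fin n → ℝ} {s : Set ℝ} {t : ℝ}
    (hx : HasDerivWithinAt x (A t *ᵥ x t) s t) :
    HasDerivWithinAt (fun τ => x τ ⬝ᵥ x τ) (2 * (x t ⬝ᵥ (A t *ᵥ x t))) s t := by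
  refine (hasDerivWithinAt_dotProduct hx hx).congr_deriv ?_
  rw [dotProduct_comm, two_mul]

theorem norm_evolutionOperator_le (hab : a ≤ b) (hA : ContinuousOn A (Set.Icc a b)) {c : ℝ}
    (hc : ∀ t ∈ Set.Icc a b, ‖A t‖ ≤ c) :
    ‖evolutionOperator A b a‖ ≤ Real.exp (c * (b - a)) := by
  refine norm_le_of_mulVec_dotProduct_self_le (Real.exp_pos _).le fun v => ?_
  have hgrowth := le_exp_mul_of_deriv_le_mul (c := 2 * c) hab
    (fun t ht => hasDerivWithinAt_dotProduct_self_trajectory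
      (evolutionOperator_mulVec_hasDerivWithinAt hA (Set.left_mem_Icc.2 hab) ht v))
    fun t ht => by linarith [(abs_le.1 (abs_dotProduct_mulVec_le (hc t ht)
      (evolutionOperator A t a *ᵥ v))).2]
  rwa [evolutionOperator_self, Matrix.one_mulVec, mul_assoc, two_mul, Real.exp_add, ← sq]
    at hgrowth

theorem norm_evolutionOperator_swap_le (hab : a ≤ b) (hA : ContinuousOn A (Set.Icc a b)) {c : ℝ}
    (hc : ∀ t ∈ Set.Icc a b, ‖A t‖ ≤ c) :
    ‖evolutionOperator A a b‖ ≤ Real.exp (c * (b - a)) := by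
  refine norm_le_of_mulVec_dotProduct_self_le (Real.exp_pos _).le fun v => ?_
  have hgrowth := exp_mul_le_of_mul_le_deriv (c := -(2 * c)) hab
    (fun t ht => hasDerivWithinAt_dotProduct_self_trajectory
      (evolutionOperator_mulVec_hasDerivWithinAt hA (Set.right_mem_Icc.2 hab) ht v))
    fun t ht => by linarith [(abs_le.1 (abs_dotProduct_mulVec_le (hc t ht)
      (evolutionOperator A t b *ᵥ v))).1]
  rw [evolutionOperator_self, Matrix.one_mulVec, neg_mul, Real.exp_neg,
    inv_mul_le_iff₀ (Real.exp_pos _)] at hgrowth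
  rwa [mul_assoc, two_mul, Real.exp_add, ← sq] at hgrowth

end EvolutionOperator

section Gramian

section Integrand

variable {l m n : Type*} [Fintype m] [Fintype n]

theorem nonneg_mul_mul_transpose_mul_transpose [Finite l] (M : Matrix l m ℝ) (N : Matrix m n ℝ) :
    0 ≤ M * N * Nᵀ * Mᵀ := by
  simpa [Matrix.mul_assoc] using (Matrix.posSemidef_self_mul_conjTranspose (M * N)).nonneg

theorem norm_mul_mul_transpose_mul_transpose_le [Fintype l] [DecidableEq l] [DecidableEq m]
    [DecidableEq n] (M : Matrix l m ℝ) (N : Matrix m n ℝ) :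
    ‖M * N * Nᵀ * Mᵀ‖ ≤ (‖M‖ * ‖N‖) ^ 2 :=
  calc ‖M * N * Nᵀ * Mᵀ‖ = ‖M * N * (M * N)ᵀ‖ := by
        rw [Matrix.transpose_mul, ← Matrix.mul_assoc]
    _ ≤ ‖M * N‖ * ‖(M * N)ᵀ‖ := Matrix.l2_opNorm_mul _ _
    _ = ‖M * N‖ ^ 2 := by rw [norm_transpose, sq]
    _ ≤ (‖M‖ * ‖N‖) ^ 2 := pow_le_pow_left₀ (norm_nonneg _) (Matrix.l2_opNorm_mul M N) 2

end Integrand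

variable {nx nu : ℕ} {a b : ℝ} {A : ℝ → Matrix (Fin nx) (Fin nx) ℝ}
  {B : ℝ → Matrix (Fin nx) (Fin nu) ℝ}

theorem gramian_self (A : ℝ → Matrix (Fin nx) (Fin nx) ℝ) (B : ℝ → Matrix (Fin nx) (Fin nu) ℝ)
    (t : ℝ) : gramian A B t t = 0 := intervalIntegral.integral_same

theorem gramian_hasDerivWithinAt (hA : ContinuousOn A (Set.Icc a b))
    (hB : ContinuousOn B (Set.Icc a b)) {s t : ℝ} (hs : s ∈ Set.Icc a b) (ht : t ∈ Set.Icc a b) :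
    HasDerivWithinAt (fun τ => gramian A B s τ)
      (evolutionOperator A s t * B t * (B t)ᵀ * (evolutionOperator A s t)ᵀ) (Set.Icc a b) t := by
  have hΦ := continuousOn_evolutionOperator_right hA hs
  have hcont : ContinuousOn
      (fun τ => evolutionOperator A s τ * B τ * (B τ)ᵀ * (evolutionOperator A s τ)ᵀ)
      (Set.Icc a b) :=
    continuousOn_matrix_mul (continuousOn_matrix_mul (continuousOn_matrix_mul hΦ hB)
      (continuousOn_matrix_transpose hB)) (continuousOn_matrix_transpose hΦ)
  have : Fact (t ∈ Set.Icc a b) := ⟨ht⟩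
  exact intervalIntegral.integral_hasDerivWithinAt_right
    (hcont.mono (Set.uIcc_subset_Icc hs ht)).intervalIntegrable
    (hcont.stronglyMeasurableAtFilter_nhdsWithin measurableSet_Icc t) (hcont t ht)

theorem gramian_mono (hA : ContinuousOn A (Set.Icc a b)) (hB : ContinuousOn B (Set.Icc a b))
    {τ : ℝ} (hτ : τ ∈ Set.Icc a b) : gramian A B a τ ≤ gramian A B a b :=
  matrix_le_of_hasDerivWithinAt_nonneg hτ.2
    (fun _ ht => (gramian_hasDerivWithinAt hA hB (Set.left_mem_Icc.2 (hτ.1.trans hτ.2))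
      (Set.Icc_subset_Icc_left hτ.1 ht)).mono (Set.Icc_subset_Icc_left hτ.1))
    fun _ _ => nonneg_mul_mul_transpose_mul_transpose _ _

theorem gramian_nonneg (hab : a ≤ b) (hA : ContinuousOn A (Set.Icc a b))
    (hB : ContinuousOn B (Set.Icc a b)) : 0 ≤ gramian A B a b := by
  simpa only [gramian_self] using gramian_mono hA hB (Set.left_mem_Icc.2 hab)

theorem gramian_le_smul_one (hab : a ≤ b) (hA : ContinuousOn A (Set.Icc a b))
    (hB : ContinuousOn B (Set.Icc a b)) {c β : ℝ} (hc : 0 < c)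
    (hAc : ∀ t ∈ Set.Icc a b, ‖A t‖ ≤ c) (hBβ : ∀ t ∈ Set.Icc a b, ‖B t‖ ≤ β) :
    gramian A B a b ≤ (β ^ 2 * (Real.exp (2 * c * (b - a)) - 1) / (2 * c)) • 1 := by
  have hderiv : ∀ t ∈ Set.Icc a b, HasDerivWithinAt
      (fun τ => (β ^ 2 * (Real.exp (2 * c * (τ - a)) - 1) / (2 * c)) • 1 - gramian A B a τ)
      ((β ^ 2 * Real.exp (2 * c * (t - a))) • 1
        - evolutionOperator A a t * B t * (B t)ᵀ * (evolutionOperator A a t)ᵀ)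
      (Set.Icc a b) t := fun t ht => by
    have hexp := ((((hasDerivWithinAt_exp_mul_sub (2 * c) a (s := Set.Icc a b) (t := t)).sub_const
      1).const_mul (β ^ 2)).div_const (2 * c)).smul_const (1 : Matrix (Fin nx) (Fin nx) ℝ)
    refine (hexp.sub (gramian_hasDerivWithinAt hA hB (Set.left_mem_Icc.2 hab) ht)).congr_deriv ?_
    congr 2
    field_simp
  have hmono := matrix_le_of_hasDerivWithinAt_nonneg hab hderiv fun t ht => sub_nonneg.2 ?_
  · simpa [gramian_self] using hmono
  refine le_smul_one_of_norm_le
    (isSymm_of_nonneg (nonneg_mul_mul_transpose_mul_transpose _ _)) ?_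
  have hΦ := norm_evolutionOperator_swap_le ht.1 (hA.mono (Set.Icc_subset_Icc_right ht.2))
    fun τ hτ => hAc τ (Set.Icc_subset_Icc_right ht.2 hτ)
  calc ‖evolutionOperator A a t * B t * (B t)ᵀ * (evolutionOperator A a t)ᵀ‖
      ≤ (‖evolutionOperator A a t‖ * ‖B t‖) ^ 2 := norm_mul_mul_transpose_mul_transpose_le _ _
    _ ≤ (Real.exp (c * (t - a)) * β) ^ 2 := by gcongr; exact hBβ t ht
    _ = β ^ 2 * Real.exp (2 * c * (t - a)) := by
        rw [mul_pow, ← Real.exp_nat_mul, Nat.cast_ofNat, mul_comm, mul_assoc]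

end Gramian

section LyapunovEquation

theorem hasDerivWithinAt_dotProduct_lyapunov {m n : Type*} [Fintype m] [Fintype n]
    {s : Set ℝ} {t : ℝ} {D : ℝ → Matrix m n ℝ} {M : Matrix m m ℝ} {N : Matrix n n ℝ}
    {W : Matrix m n ℝ} {y : ℝ → m → ℝ} {x : ℝ → n → ℝ}
    (hD : HasDerivWithinAt D (-(Mᵀ * D t) - D t * N - W) s t)
    (hy : HasDerivWithinAt y (M *ᵥ y t) s t) (hx : HasDerivWithinAt x (N *ᵥ x t) s t) :
    HasDerivWithinAt (fun τ => y τ ⬝ᵥ (D τ *ᵥ x τ)) (-(y t ⬝ᵥ (W *ᵥ x t))) s t := by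
  refine (hasDerivWithinAt_dotProduct hy (hasDerivWithinAt_mulVec hD hx)).congr_deriv ?_
  simp only [Matrix.sub_mulVec, Matrix.neg_mulVec, ← Matrix.mulVec_mulVec, dotProduct_add,
    dotProduct_sub, dotProduct_neg, Matrix.dotProduct_transpose_mulVec]
  rw [dotProduct_comm (M *ᵥ y t)]
  ring

variable {m n : ℕ} {a b : ℝ}

theorem dotProduct_mulVec_le_of_lyapunov (hab : a ≤ b) {D W : ℝ → Matrix (Fin m) (Fin n) ℝ}
    {M : ℝ → Matrix (Fin m) (Fin m) ℝ} {N : ℝ → Matrix (Fin n) (Fin n) ℝ}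
    (hD : ∀ t ∈ Set.Icc a b,
      HasDerivWithinAt D (-((M t)ᵀ * D t) - D t * N t - W t) (Set.Icc a b) t)
    {y : ℝ → Fin m → ℝ} {x : ℝ → Fin n → ℝ}
    (hy : ∀ t ∈ Set.Icc a b, HasDerivWithinAt y (M t *ᵥ y t) (Set.Icc a b) t)
    (hx : ∀ t ∈ Set.Icc a b, HasDerivWithinAt x (N t *ᵥ x t) (Set.Icc a b) t)
    (hW : ∀ t ∈ Set.Icc a b, 0 ≤ y t ⬝ᵥ (W t *ᵥ x t)) :
    y b ⬝ᵥ (D b *ᵥ x b) ≤ y a ⬝ᵥ (D a *ᵥ x a) := by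
  have hmono := le_of_hasDerivWithinAt_nonneg hab
    (fun t ht => (hasDerivWithinAt_dotProduct_lyapunov (hD t ht) (hy t ht) (hx t ht)).neg)
    fun t ht => by simpa only [neg_neg] using hW t ht
  exact neg_le_neg_iff.1 hmono

theorem eq_zero_of_sylvester (hab : a ≤ b) {D : ℝ → Matrix (Fin m) (Fin n) ℝ}
    {M : ℝ → Matrix (Fin m) (Fin m) ℝ} {N : ℝ → Matrix (Fin n) (Fin n) ℝ}
    (hM : ContinuousOn M (Set.Icc a b)) (hN : ContinuousOn N (Set.Icc a b))
    (hD : ∀ t ∈ Set.Icc a b, HasDerivWithinAt D (-((M t)ᵀ * D t) - D t * N t) (Set.Icc a b) t)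
    (hb : D b = 0) : D a = 0 := by
  have hnonneg : ∀ v w, 0 ≤ w ⬝ᵥ (D a *ᵥ v) := fun v w => by
    have hle := dotProduct_mulVec_le_of_lyapunov (W := 0) hab
      (by simpa only [Pi.zero_apply, sub_zero] using hD)
      (fun t ht => evolutionOperator_mulVec_hasDerivWithinAt hM (Set.left_mem_Icc.2 hab) ht w)
      (fun t ht => evolutionOperator_mulVec_hasDerivWithinAt hN (Set.left_mem_Icc.2 hab) ht v)
      (by simp)
    simpa only [hb, evolutionOperator_self, Matrix.zero_mulVec, dotProduct_zero,
      Matrix.one_mulVec] using hle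
  refine Matrix.mulVec_injective (funext fun v => ?_)
  rw [Matrix.zero_mulVec]
  refine dotProduct_eq_zero _ fun w => ?_
  rw [dotProduct_comm]
  exact le_antisymm (by simpa using hnonneg v (-w)) (hnonneg v w)

end LyapunovEquation

/-- `S` solves the matrix Riccati equation `Ṡ = S G S - S F - Fᵀ S - Q` on `[a, b]`, with one-sided
derivatives at the end points. The terminal value is left free. -/
def SolvesRiccati {n : ℕ} (F G Q S : ℝ → Matrix (Fin n) (Fin n) ℝ) (a b : ℝ) : Prop :=
  ∀ t ∈ Set.Icc a b,
    HasDerivWithinAt S (S t * G t * S t - S t * F t - (F t)ᵀ * S t - Q t) (Set.Icc a b) t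

namespace SolvesRiccati

variable {n : ℕ} {a b : ℝ} {F G Q S : ℝ → Matrix (Fin n) (Fin n) ℝ}

theorem mono {a' b' : ℝ} (hS : SolvesRiccati F G Q S a b)
    (h : Set.Icc a' b' ⊆ Set.Icc a b) : SolvesRiccati F G Q S a' b' :=
  fun t ht => (hS t (h ht)).mono h

theorem continuousOn (hS : SolvesRiccati F G Q S a b) : ContinuousOn S (Set.Icc a b) :=
  fun t ht => (hS t ht).continuousWithinAt

theorem eqOn {S' : ℝ → Matrix (Fin n) (Fin n) ℝ} (hF : ContinuousOn F (Set.Icc a b))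
    (hG : ContinuousOn G (Set.Icc a b)) (hS : SolvesRiccati F G Q S a b)
    (hS' : SolvesRiccati F G Q S' a b) (hb : S b = S' b) : Set.EqOn S S' (Set.Icc a b) := by
  intro t ht
  have hsub : Set.Icc t b ⊆ Set.Icc a b := Set.Icc_subset_Icc_left ht.1
  refine sub_eq_zero.1 (eq_zero_of_sylvester (D := fun τ => S τ - S' τ)
    (M := fun τ => F τ - (G τ)ᵀ * (S τ)ᵀ) (N := fun τ => F τ - G τ * S' τ) ht.2
    ((hF.sub (continuousOn_matrix_mul (continuousOn_matrix_transpose hG)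
      (continuousOn_matrix_transpose hS.continuousOn))).mono hsub)
    ((hF.sub (continuousOn_matrix_mul hG hS'.continuousOn)).mono hsub)
    (fun τ hτ => ((hS.mono hsub τ hτ).sub (hS'.mono hsub τ hτ)).congr_deriv ?_)
    (sub_eq_zero.2 hb))
  simp only [Matrix.transpose_sub, Matrix.transpose_mul, Matrix.transpose_transpose]
  noncomm_ring

theorem transpose (hG : ∀ t ∈ Set.Icc a b, (G t).IsSymm) (hQ : ∀ t ∈ Set.Icc a b, (Q t).IsSymm)
    (hS : SolvesRiccati F G Q S a b) : SolvesRiccati F G Q (fun t => (S t)ᵀ) a b := fun t ht => by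
  refine (hasDerivWithinAt_matrix_transpose (hS t ht)).congr_deriv ?_
  simp only [Matrix.transpose_sub, Matrix.transpose_mul, Matrix.transpose_transpose,
    (hG t ht).eq, (hQ t ht).eq]
  noncomm_ring

theorem isSymm (hF : ContinuousOn F (Set.Icc a b)) (hG : ContinuousOn G (Set.Icc a b))
    (hGs : ∀ t ∈ Set.Icc a b, (G t).IsSymm) (hQs : ∀ t ∈ Set.Icc a b, (Q t).IsSymm)
    (hS : SolvesRiccati F G Q S a b) (hb : (S b).IsSymm) {t : ℝ} (ht : t ∈ Set.Icc a b) :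
    (S t).IsSymm :=
  (hS.transpose hGs hQs).eqOn hF hG hS hb ht

theorem le_of_weight_le {Q₁ Q₂ S₁ S₂ : ℝ → Matrix (Fin n) (Fin n) ℝ}
    (hF : ContinuousOn F (Set.Icc a b)) (hG : ContinuousOn G (Set.Icc a b))
    (hGs : ∀ t ∈ Set.Icc a b, (G t).IsSymm) (hS₁ : SolvesRiccati F G Q₁ S₁ a b)
    (hS₂ : SolvesRiccati F G Q₂ S₂ a b) (hS₁s : ∀ t ∈ Set.Icc a b, (S₁ t).IsSymm)
    (hS₂s : ∀ t ∈ Set.Icc a b, (S₂ t).IsSymm) (hQ : ∀ t ∈ Set.Icc a b, Q₁ t ≤ Q₂ t)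
    (hb : S₁ b ≤ S₂ b) {t : ℝ} (ht : t ∈ Set.Icc a b) : S₁ t ≤ S₂ t := by
  refine le_iff_isSymm_dotProduct.2 ⟨(hS₂s t ht).sub (hS₁s t ht), fun v => ?_⟩
  have hsub : Set.Icc t b ⊆ Set.Icc a b := Set.Icc_subset_Icc_left ht.1
  -- `S G S` polarizes around the mean of the two solutions, so the difference solves a Lyapunov
  -- equation with drift `N`.
  let N := fun τ => F τ - (1 / 2 : ℝ) • (G τ * (S₁ τ + S₂ τ))
  have hN : ContinuousOn N (Set.Icc a b) := hF.sub ((continuousOn_matrix_mul hG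
    (hS₁.continuousOn.add hS₂.continuousOn)).const_smul (1 / 2 : ℝ))
  have hx := fun τ (hτ : τ ∈ Set.Icc t b) =>
    evolutionOperator_mulVec_hasDerivWithinAt (hN.mono hsub) (Set.left_mem_Icc.2 ht.2) hτ v
  have hle := dotProduct_mulVec_le_of_lyapunov (D := fun τ => S₂ τ - S₁ τ)
    (W := fun τ => Q₂ τ - Q₁ τ) ht.2
    (fun τ hτ => ((hS₂.mono hsub τ hτ).sub (hS₁.mono hsub τ hτ)).congr_deriv ?_) hx hx
    fun τ hτ => dotProduct_mulVec_nonneg (sub_nonneg.2 (hQ τ (hsub hτ))) _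
  · have hnonneg := (dotProduct_mulVec_nonneg (sub_nonneg.2 hb) _).trans hle
    simpa only [evolutionOperator_self, Matrix.one_mulVec, Matrix.sub_mulVec, dotProduct_sub,
      sub_nonneg] using hnonneg
  · simp only [N, Matrix.transpose_sub, Matrix.transpose_smul, Matrix.transpose_mul,
      Matrix.transpose_add, (hGs τ (hsub hτ)).eq, (hS₁s τ (hsub hτ)).eq, (hS₂s τ (hsub hτ)).eq,
      sub_mul, mul_sub, smul_mul_assoc, mul_smul_comm, add_mul, mul_add, smul_add, smul_sub,
      ← mul_assoc]
    module

section ScalarComparison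

variable {φ φ' : ℝ → ℝ}

theorem smul_one (hφ : ∀ t ∈ Set.Icc a b, HasDerivWithinAt φ (φ' t) (Set.Icc a b) t) :
    SolvesRiccati F G (fun t => φ t ^ 2 • G t - φ t • (F t + (F t)ᵀ) - φ' t • 1)
      (fun t => φ t • 1) a b := fun t ht => by
  refine ((hφ t ht).smul_const (1 : Matrix (Fin n) (Fin n) ℝ)).congr_deriv ?_
  simp only [smul_mul_assoc, mul_smul_comm, one_mul, mul_one]
  module

theorem smul_one_le {ω β γ : ℝ} (hF : ContinuousOn F (Set.Icc a b))
    (hG : ContinuousOn G (Set.Icc a b)) (hS : SolvesRiccati F G Q S a b)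
    (hω : ∀ t ∈ Set.Icc a b, ‖F t‖ ≤ ω) (hβ : ∀ t ∈ Set.Icc a b, G t ≤ β • 1)
    (hγ : ∀ t ∈ Set.Icc a b, γ • 1 ≤ Q t) (hφ₀ : ∀ t ∈ Set.Icc a b, 0 ≤ φ t)
    (hφ : ∀ t ∈ Set.Icc a b, HasDerivWithinAt φ (φ' t) (Set.Icc a b) t)
    (hsub : ∀ t ∈ Set.Icc a b, β * φ t ^ 2 + 2 * ω * φ t - φ' t ≤ γ)
    (hb : φ b • 1 ≤ S b) {t : ℝ} (ht : t ∈ Set.Icc a b) : φ t • 1 ≤ S t := by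
  have hGs : ∀ τ ∈ Set.Icc a b, (G τ).IsSymm := fun τ hτ => (le_smul_one_iff.1 (hβ τ hτ)).1
  have hQs : ∀ τ ∈ Set.Icc a b, (Q τ).IsSymm := fun τ hτ => (smul_one_le_iff.1 (hγ τ hτ)).1
  refine le_of_weight_le hF hG hGs (smul_one hφ) hS
    (fun τ _ => Matrix.isSymm_one.smul (φ τ))
    (fun τ hτ => hS.isSymm hF hG hGs hQs (smul_one_le_iff.1 hb).1 hτ) (fun τ hτ => ?_) hb ht
  refine le_trans (le_smul_one_iff.2 ⟨?_, fun x => ?_⟩) (hγ τ hτ)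
  · exact (((hGs τ hτ).smul _).sub ((Matrix.isSymm_add_transpose_self _).smul _)).sub
      (Matrix.isSymm_one.smul _)
  · have hFx := (abs_le.1 (abs_dotProduct_mulVec_le (hω τ hτ) x)).1
    have hGx := (le_smul_one_iff.1 (hβ τ hτ)).2 x
    simp only [Matrix.sub_mulVec, Matrix.smul_mulVec, Matrix.add_mulVec, Matrix.one_mulVec,
      dotProduct_sub, dotProduct_add, dotProduct_smul, smul_eq_mul,
      Matrix.dotProduct_transpose_mulVec]
    linarith [mul_le_mul_of_nonneg_left hFx (hφ₀ τ hτ),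
      mul_le_mul_of_nonneg_left hGx (sq_nonneg (φ τ)),
      mul_le_mul_of_nonneg_right (hsub τ hτ) (dotProduct_self_nonneg x)]

theorem le_smul_one {ω q : ℝ} (hF : ContinuousOn F (Set.Icc a b))
    (hG : ContinuousOn G (Set.Icc a b)) (hS : SolvesRiccati F G Q S a b)
    (hω : ∀ t ∈ Set.Icc a b, ‖F t‖ ≤ ω) (hG₀ : ∀ t ∈ Set.Icc a b, 0 ≤ G t)
    (hq : ∀ t ∈ Set.Icc a b, Q t ≤ q • 1) (hφ₀ : ∀ t ∈ Set.Icc a b, 0 ≤ φ t)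
    (hφ : ∀ t ∈ Set.Icc a b, HasDerivWithinAt φ (φ' t) (Set.Icc a b) t)
    (hsuper : ∀ t ∈ Set.Icc a b, q ≤ -(2 * ω * φ t) - φ' t)
    (hb : S b ≤ φ b • 1) {t : ℝ} (ht : t ∈ Set.Icc a b) : S t ≤ φ t • 1 := by
  have hGs : ∀ τ ∈ Set.Icc a b, (G τ).IsSymm := fun τ hτ => isSymm_of_nonneg (hG₀ τ hτ)
  have hQs : ∀ τ ∈ Set.Icc a b, (Q τ).IsSymm := fun τ hτ => (le_smul_one_iff.1 (hq τ hτ)).1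
  refine le_of_weight_le hF hG hGs hS (smul_one hφ)
    (fun τ hτ => hS.isSymm hF hG hGs hQs (le_smul_one_iff.1 hb).1 hτ)
    (fun τ _ => Matrix.isSymm_one.smul (φ τ)) (fun τ hτ => ?_) hb ht
  refine (hq τ hτ).trans (smul_one_le_iff.2 ⟨?_, fun x => ?_⟩)
  · exact (((hGs τ hτ).smul _).sub ((Matrix.isSymm_add_transpose_self _).smul _)).sub
      (Matrix.isSymm_one.smul _)
  · have hFx := (abs_le.1 (abs_dotProduct_mulVec_le (hω τ hτ) x)).2
    simp only [Matrix.sub_mulVec, Matrix.smul_mulVec, Matrix.add_mulVec, Matrix.one_mulVec,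
      dotProduct_sub, dotProduct_add, dotProduct_smul, smul_eq_mul,
      Matrix.dotProduct_transpose_mulVec]
    linarith [mul_le_mul_of_nonneg_left hFx (hφ₀ τ hτ),
      mul_nonneg (sq_nonneg (φ τ)) (dotProduct_mulVec_nonneg (hG₀ τ hτ) x),
      mul_le_mul_of_nonneg_right (hsuper τ hτ) (dotProduct_self_nonneg x)]

end ScalarComparison

end SolvesRiccati

section Existence

theorem exists_linear_matrix_solution {ι m : Type*} [Fintype ι] [Finite m] {a b : ℝ}
    {A : ℝ → Matrix ι ι ℝ} (hA : ContinuousOn A (Set.Icc a b)) {t₀ : ℝ} (ht₀ : t₀ ∈ Set.Icc a b)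
    (K : Matrix ι m ℝ) : ∃ X : ℝ → Matrix ι m ℝ, X t₀ = K ∧
      ∀ t ∈ Set.Icc a b, HasDerivWithinAt X (A t * X t) (Set.Icc a b) t := by
  classical
  cases nonempty_fintype m
  let e := Fintype.equivFin ι
  let A' := fun t => (A t).submatrix e.symm e.symm
  have hA' : ContinuousOn A' (Set.Icc a b) :=
    (continuous_id.matrix_submatrix e.symm e.symm).comp_continuousOn hA
  have hΦ : ∀ t ∈ Set.Icc a b, HasDerivWithinAt
      (fun t => (evolutionOperator A' t t₀).submatrix e e)
      (A t * (evolutionOperator A' t t₀).submatrix e e) (Set.Icc a b) t := fun t ht => by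
    have hentries := hasDerivWithinAt_matrix_iff.1 (evolutionOperator_hasDerivWithinAt hA' ht₀ ht)
    refine (hasDerivWithinAt_matrix_iff.2 fun i j => hentries (e i) (e j)).congr_deriv ?_
    change (A' t * evolutionOperator A' t t₀).submatrix e e = _
    rw [← Matrix.submatrix_mul_equiv _ _ e e e]
    simp [A']
  refine ⟨fun t => (evolutionOperator A' t t₀).submatrix e e * K, ?_, fun t ht => ?_⟩
  · simp [evolutionOperator_self]
  · simpa [Matrix.mul_assoc] using
      hasDerivWithinAt_matrix_mul (hΦ t ht) (hasDerivWithinAt_const t _ K)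

variable {n : ℕ} {a b : ℝ} {F G Q : ℝ → Matrix (Fin n) (Fin n) ℝ}

theorem exists_hamiltonian_solution (hab : a ≤ b) (hF : ContinuousOn F (Set.Icc a b))
    (hG : ContinuousOn G (Set.Icc a b)) (hQ : ContinuousOn Q (Set.Icc a b))
    (K : Matrix (Fin n) (Fin n) ℝ) :
    ∃ X Y : ℝ → Matrix (Fin n) (Fin n) ℝ, X b = 1 ∧ Y b = K ∧
      (∀ t ∈ Set.Icc a b, HasDerivWithinAt X (F t * X t - G t * Y t) (Set.Icc a b) t) ∧
      ∀ t ∈ Set.Icc a b, HasDerivWithinAt Y (-(Q t * X t) - (F t)ᵀ * Y t) (Set.Icc a b) t := by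
  have hcont : ContinuousOn (fun t => Matrix.fromBlocks (F t) (-G t) (-Q t) (-(F t)ᵀ))
      (Set.Icc a b) := by
    rw [continuousOn_iff_continuous_domRestrict] at *
    exact hF.matrix_fromBlocks hG.neg hQ.neg hF.matrix_transpose.neg
  obtain ⟨Z, hZb, hZ⟩ := exists_linear_matrix_solution hcont (Set.right_mem_Icc.2 hab)
    (Matrix.fromRows 1 K)
  have hZblock : ∀ t ∈ Set.Icc a b, HasDerivWithinAt Z (Matrix.fromRows
      (F t * (Z t).toRows₁ - G t * (Z t).toRows₂) (-(Q t * (Z t).toRows₁) - (F t)ᵀ * (Z t).toRows₂))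
      (Set.Icc a b) t := fun t ht => (hZ t ht).congr_deriv <| by
    conv_lhs => rw [← Matrix.fromRows_toRows (Z t), Matrix.fromBlocks_mul_fromRows]
    simp only [Matrix.neg_mul, sub_eq_add_neg]
  refine ⟨fun t => (Z t).toRows₁, fun t => (Z t).toRows₂, by simp [hZb], by simp [hZb],
    fun t ht => ?_, fun t ht => ?_⟩
  · exact hasDerivWithinAt_matrix_iff.2 fun i j =>
      hasDerivWithinAt_matrix_iff.1 (hZblock t ht) (Sum.inl i) j
  · exact hasDerivWithinAt_matrix_iff.2 fun i j =>
      hasDerivWithinAt_matrix_iff.1 (hZblock t ht) (Sum.inr i) j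

theorem isUnit_of_hamiltonian {K : Matrix (Fin n) (Fin n) ℝ} (hK : K.PosDef)
    (hG₀ : ∀ t ∈ Set.Icc a b, 0 ≤ G t) (hQ₀ : ∀ t ∈ Set.Icc a b, 0 ≤ Q t)
    {X Y : ℝ → Matrix (Fin n) (Fin n) ℝ} (hXb : X b = 1) (hYb : Y b = K)
    (hX : ∀ t ∈ Set.Icc a b, HasDerivWithinAt X (F t * X t - G t * Y t) (Set.Icc a b) t)
    (hY : ∀ t ∈ Set.Icc a b, HasDerivWithinAt Y (-(Q t * X t) - (F t)ᵀ * Y t) (Set.Icc a b) t)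
    {t : ℝ} (ht : t ∈ Set.Icc a b) : IsUnit (X t) := by
  have hsub : Set.Icc t b ⊆ Set.Icc a b := Set.Icc_subset_Icc_left ht.1
  rw [← Matrix.mulVec_injective_iff_isUnit]
  refine (injective_iff_map_eq_zero (X t).mulVecLin).2 fun ξ hξ => ?_
  rw [Matrix.mulVecLin_apply] at hξ
  -- `τ ↦ Xξ ⬝ Yξ` is nonincreasing, so `Xξ = 0` at `t` forces `ξ ⬝ Kξ ≤ 0`.
  have hderiv : ∀ τ ∈ Set.Icc t b, HasDerivWithinAt (fun τ => -((X τ *ᵥ ξ) ⬝ᵥ (Y τ *ᵥ ξ)))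
      ((X τ *ᵥ ξ) ⬝ᵥ (Q τ *ᵥ (X τ *ᵥ ξ)) + (Y τ *ᵥ ξ) ⬝ᵥ (G τ *ᵥ (Y τ *ᵥ ξ)))
      (Set.Icc t b) τ := fun τ hτ => by
    refine (hasDerivWithinAt_dotProduct
      (hasDerivWithinAt_mulVec_const ((hX τ (hsub hτ)).mono hsub) ξ)
      (hasDerivWithinAt_mulVec_const ((hY τ (hsub hτ)).mono hsub) ξ)).neg.congr_deriv ?_
    simp only [Matrix.sub_mulVec, Matrix.neg_mulVec, ← Matrix.mulVec_mulVec, sub_dotProduct,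
      dotProduct_sub, dotProduct_neg, Matrix.dotProduct_transpose_mulVec]
    rw [dotProduct_comm (G τ *ᵥ _), dotProduct_comm (F τ *ᵥ _)]
    ring
  have hmono := le_of_hasDerivWithinAt_nonneg ht.2 hderiv fun τ hτ =>
    add_nonneg (dotProduct_mulVec_nonneg (hQ₀ τ (hsub hτ)) _)
      (dotProduct_mulVec_nonneg (hG₀ τ (hsub hτ)) _)
  simp only [hξ, zero_dotProduct, neg_zero, hXb, hYb, Matrix.one_mulVec] at hmono
  by_contra hne
  have hpos := hK.dotProduct_mulVec_pos hne
  rw [star_trivial] at hpos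
  linarith

theorem exists_solvesRiccati (hab : a ≤ b) (hF : ContinuousOn F (Set.Icc a b))
    (hG : ContinuousOn G (Set.Icc a b)) (hQ : ContinuousOn Q (Set.Icc a b))
    (hG₀ : ∀ t ∈ Set.Icc a b, 0 ≤ G t) (hQ₀ : ∀ t ∈ Set.Icc a b, 0 ≤ Q t)
    {K : Matrix (Fin n) (Fin n) ℝ} (hK : K.PosDef) :
    ∃ S, SolvesRiccati F G Q S a b ∧ S b = K := by
  obtain ⟨X, Y, hXb, hYb, hX, hY⟩ := exists_hamiltonian_solution hab hF hG hQ K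
  refine ⟨fun t => Y t * (X t)⁻¹, fun t ht => ?_, by simp [hXb, hYb]⟩
  have hunit := isUnit_of_hamiltonian hK hG₀ hQ₀ hXb hYb hX hY ht
  have hcancel : X t * (X t)⁻¹ = 1 :=
    Matrix.mul_nonsing_inv _ ((Matrix.isUnit_iff_isUnit_det _).1 hunit)
  refine (hasDerivWithinAt_matrix_mul (hY t ht)
    (hasDerivWithinAt_matrix_inv (hX t ht) hunit)).congr_deriv ?_
  beta_reduce
  generalize (X t)⁻¹ = V at hcancel ⊢
  calc (-(Q t * X t) - (F t)ᵀ * Y t) * V + Y t * -(V * (F t * X t - G t * Y t) * V)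
      = -(Q t * (X t * V)) - (F t)ᵀ * (Y t * V) - Y t * V * F t * (X t * V)
        + Y t * V * G t * (Y t * V) := by noncomm_ring
    _ = Y t * V * G t * (Y t * V) - Y t * V * F t - (F t)ᵀ * (Y t * V) - Q t := by
        rw [hcancel]; noncomm_ring

end Existence

section ValueFunction

theorem zero_le_completion_of_square {m n : Type*} [Fintype m] [Fintype n] [DecidableEq m]
    (B : Matrix n m ℝ) {R : Matrix m m ℝ} (hR : R.PosDef) (y : n → ℝ) (w : m → ℝ) :
    0 ≤ y ⬝ᵥ ((B * R⁻¹ * Bᵀ) *ᵥ y) + 2 * (y ⬝ᵥ (B *ᵥ w)) + w ⬝ᵥ (R *ᵥ w) := by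
  have hcancel : R * R⁻¹ = 1 :=
    Matrix.mul_nonsing_inv _ ((Matrix.isUnit_iff_isUnit_det _).1 hR.isUnit)
  have hRs : R.IsSymm := isSymm_of_nonneg hR.posSemidef.nonneg
  obtain ⟨z, hz⟩ : ∃ z, z = Bᵀ *ᵥ y := ⟨_, rfl⟩
  have hsq := dotProduct_mulVec_nonneg hR.posSemidef.nonneg (w + R⁻¹ *ᵥ z)
  have hzz : y ⬝ᵥ ((B * R⁻¹ * Bᵀ) *ᵥ y) = z ⬝ᵥ (R⁻¹ *ᵥ z) := by
    rw [hz, mulVec_dotProduct_mulVec, Matrix.transpose_transpose]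
  have hzw : y ⬝ᵥ (B *ᵥ w) = w ⬝ᵥ z := by rw [hz, Matrix.dotProduct_transpose_mulVec]
  simp only [Matrix.mulVec_add, add_dotProduct, dotProduct_add, Matrix.mulVec_mulVec, hcancel,
    Matrix.one_mulVec, dotProduct_comm (R⁻¹ *ᵥ z) z] at hsq
  rw [isSymm_dotProduct_mulVec_comm hRs (R⁻¹ *ᵥ z) w, Matrix.mulVec_mulVec, hcancel,
    Matrix.one_mulVec] at hsq
  rw [hzz, hzw]
  linarith

namespace SolvesRiccati

variable {n : ℕ} {a b : ℝ} {F G Q S : ℝ → Matrix (Fin n) (Fin n) ℝ}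

theorem hasDerivWithinAt_dotProduct_mulVec (hS : SolvesRiccati F G Q S a b) {t : ℝ}
    (ht : t ∈ Set.Icc a b) (hSs : (S t).IsSymm) {x : ℝ → Fin n → ℝ} {x' : Fin n → ℝ}
    (hx : HasDerivWithinAt x x' (Set.Icc a b) t) :
    HasDerivWithinAt (fun τ => x τ ⬝ᵥ (S τ *ᵥ x τ))
      ((S t *ᵥ x t) ⬝ᵥ (G t *ᵥ (S t *ᵥ x t)) - x t ⬝ᵥ (Q t *ᵥ x t)
        + 2 * ((S t *ᵥ x t) ⬝ᵥ (x' - F t *ᵥ x t))) (Set.Icc a b) t := by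
  refine (hasDerivWithinAt_dotProduct hx (hasDerivWithinAt_mulVec (hS t ht) hx)).congr_deriv ?_
  have hSx : ∀ y, x t ⬝ᵥ (S t *ᵥ y) = (S t *ᵥ x t) ⬝ᵥ y := fun y => by
    rw [isSymm_dotProduct_mulVec_comm hSs, dotProduct_comm]
  simp only [Matrix.sub_mulVec, ← Matrix.mulVec_mulVec, dotProduct_add, dotProduct_sub,
    Matrix.dotProduct_transpose_mulVec, hSx]
  rw [dotProduct_comm x']
  ring

theorem dotProduct_mulVec_le_add_cost {m : ℕ} {B : ℝ → Matrix (Fin n) (Fin m) ℝ}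
    {R : ℝ → Matrix (Fin m) (Fin m) ℝ} (hab : a ≤ b)
    (hS : SolvesRiccati F (fun t => B t * (R t)⁻¹ * (B t)ᵀ) Q S a b)
    (hSs : ∀ t ∈ Set.Icc a b, (S t).IsSymm) (hR : ∀ t ∈ Set.Icc a b, (R t).PosDef)
    {x : ℝ → Fin n → ℝ} {w : ℝ → Fin m → ℝ}
    (hx : ∀ t ∈ Set.Icc a b, HasDerivWithinAt x (F t *ᵥ x t + B t *ᵥ w t) (Set.Icc a b) t)
    {g g' : ℝ → ℝ} (hg : ∀ t ∈ Set.Icc a b, HasDerivWithinAt g (g' t) (Set.Icc a b) t)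
    (hcost : ∀ t ∈ Set.Icc a b, x t ⬝ᵥ (Q t *ᵥ x t) + w t ⬝ᵥ (R t *ᵥ w t) ≤ g' t) :
    x a ⬝ᵥ (S a *ᵥ x a) ≤ x b ⬝ᵥ (S b *ᵥ x b) + (g b - g a) := by
  have hmono := le_of_hasDerivWithinAt_nonneg hab
    (fun t ht => (hS.hasDerivWithinAt_dotProduct_mulVec ht (hSs t ht) (hx t ht)).add (hg t ht))
    fun t ht => by
      rw [add_sub_cancel_left]
      linarith [hcost t ht, zero_le_completion_of_square (B t) (hR t ht) (S t *ᵥ x t) (w t)]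
  simp only [Pi.add_apply] at hmono
  linarith

theorem dotProduct_mulVec_closedLoop_le (hab : a ≤ b) (hS : SolvesRiccati F G Q S a b)
    (hG₀ : ∀ t ∈ Set.Icc a b, 0 ≤ G t) {γ c : ℝ} (hγ₀ : 0 ≤ γ) (hc : 0 < c)
    (hγ : ∀ t ∈ Set.Icc a b, γ • 1 ≤ Q t) (hSc : ∀ t ∈ Set.Icc a b, S t ≤ c • 1)
    {x : ℝ → Fin n → ℝ}
    (hx : ∀ t ∈ Set.Icc a b, HasDerivWithinAt x ((F t - G t * S t) *ᵥ x t) (Set.Icc a b) t) :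
    x b ⬝ᵥ (S b *ᵥ x b) ≤ Real.exp (-(γ / c) * (b - a)) * (x a ⬝ᵥ (S a *ᵥ x a)) := by
  refine le_exp_mul_of_deriv_le_mul hab (fun t ht => hS.hasDerivWithinAt_dotProduct_mulVec ht
    (le_smul_one_iff.1 (hSc t ht)).1 (hx t ht)) fun t ht => ?_
  have hGx := dotProduct_mulVec_nonneg (hG₀ t ht) (S t *ᵥ x t)
  have hQx := (smul_one_le_iff.1 (hγ t ht)).2 (x t)
  have hSx : γ / c * (x t ⬝ᵥ (S t *ᵥ x t)) ≤ γ * (x t ⬝ᵥ x t) := by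
    rw [div_mul_eq_mul_div, div_le_iff₀ hc, mul_assoc]
    exact mul_le_mul_of_nonneg_left
      (((le_smul_one_iff.1 (hSc t ht)).2 (x t)).trans_eq (mul_comm _ _)) hγ₀
  simp only [Matrix.sub_mulVec, ← Matrix.mulVec_mulVec, sub_sub_cancel_left, dotProduct_neg]
  linarith

theorem norm_evolutionOperator_closedLoop_le (hab : a ≤ b) (hF : ContinuousOn F (Set.Icc a b))
    (hG : ContinuousOn G (Set.Icc a b)) (hS : SolvesRiccati F G Q S a b)
    (hG₀ : ∀ t ∈ Set.Icc a b, 0 ≤ G t) {γ c₀ c₁ : ℝ} (hγ₀ : 0 ≤ γ) (hc₀ : 0 < c₀) (hc₁ : 0 < c₁)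
    (hγ : ∀ t ∈ Set.Icc a b, γ • 1 ≤ Q t) (hSc₀ : ∀ t ∈ Set.Icc a b, c₀ • 1 ≤ S t)
    (hSc₁ : ∀ t ∈ Set.Icc a b, S t ≤ c₁ • 1) :
    ‖evolutionOperator (fun t => F t - G t * S t) b a‖ ≤
      √(c₁ / c₀) * Real.exp (-(γ / (2 * c₁)) * (b - a)) := by
  refine norm_le_of_mulVec_dotProduct_self_le (by positivity) fun v => ?_
  have ha := Set.left_mem_Icc.2 hab
  have hcont : ContinuousOn (fun t => F t - G t * S t) (Set.Icc a b) :=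
    hF.sub (continuousOn_matrix_mul hG hS.continuousOn)
  have hdecay := hS.dotProduct_mulVec_closedLoop_le hab hG₀ hγ₀ hc₁ hγ hSc₁ fun t ht =>
    evolutionOperator_mulVec_hasDerivWithinAt hcont ha ht v
  rw [evolutionOperator_self, Matrix.one_mulVec] at hdecay
  have hlower := (smul_one_le_iff.1 (hSc₀ b (Set.right_mem_Icc.2 hab))).2
    (evolutionOperator (fun t => F t - G t * S t) b a *ᵥ v)
  have hupper := (le_smul_one_iff.1 (hSc₁ a ha)).2 v
  rw [mul_pow, Real.sq_sqrt (by positivity), ← Real.exp_nat_mul,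
    show ((2 : ℕ) : ℝ) * (-(γ / (2 * c₁)) * (b - a)) = -(γ / c₁) * (b - a) by
      push_cast; field_simp, div_mul_eq_mul_div, div_mul_eq_mul_div, le_div_iff₀ hc₀]
  linarith [mul_le_mul_of_nonneg_left hupper (Real.exp_pos (-(γ / c₁) * (b - a))).le]

end SolvesRiccati

end ValueFunction

section Steering

variable {nx nu : ℕ} {a b : ℝ} {A : ℝ → Matrix (Fin nx) (Fin nx) ℝ}
  {B : ℝ → Matrix (Fin nx) (Fin nu) ℝ} {x₀ : Fin nx → ℝ}

/-- The minimum energy control `u(τ) = -B(τ)ᵀ Φ_A(a, τ)ᵀ W(a, b)⁻¹ x₀`, which steers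
`ẋ = A x + B u` from `x(a) = x₀` to `x(b) = 0`. -/
noncomputable def steeringControl (A : ℝ → Matrix (Fin nx) (Fin nx) ℝ)
    (B : ℝ → Matrix (Fin nx) (Fin nu) ℝ) (a b : ℝ) (x₀ : Fin nx → ℝ) (τ : ℝ) : Fin nu → ℝ :=
  -((B τ)ᵀ *ᵥ ((evolutionOperator A a τ)ᵀ *ᵥ ((gramian A B a b)⁻¹ *ᵥ x₀)))

/-- The trajectory of `ẋ = A x + B u`, `x(a) = x₀`, under the control `steeringControl`, in the
closed form given by variation of constants. -/
noncomputable def steeringState (A : ℝ → Matrix (Fin nx) (Fin nx) ℝ)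
    (B : ℝ → Matrix (Fin nx) (Fin nu) ℝ) (a b : ℝ) (x₀ : Fin nx → ℝ) (τ : ℝ) : Fin nx → ℝ :=
  evolutionOperator A τ a *ᵥ (x₀ - gramian A B a τ *ᵥ ((gramian A B a b)⁻¹ *ᵥ x₀))

/-- The energy `∫ s in a..τ, |u(s)|²` of the control `steeringControl` up to time `τ`, in closed
form. -/
noncomputable def steeringEnergy (A : ℝ → Matrix (Fin nx) (Fin nx) ℝ)
    (B : ℝ → Matrix (Fin nx) (Fin nu) ℝ) (a b : ℝ) (x₀ : Fin nx → ℝ) (τ : ℝ) : ℝ :=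
  ((gramian A B a b)⁻¹ *ᵥ x₀) ⬝ᵥ (gramian A B a τ *ᵥ ((gramian A B a b)⁻¹ *ᵥ x₀))

theorem gramian_mulVec_inv_mulVec {α₀ : ℝ} (hα₀ : 0 < α₀) (hW : α₀ • 1 ≤ gramian A B a b)
    (x₀ : Fin nx → ℝ) : gramian A B a b *ᵥ ((gramian A B a b)⁻¹ *ᵥ x₀) = x₀ := by
  rw [Matrix.mulVec_mulVec, Matrix.mul_nonsing_inv _
    ((Matrix.isUnit_iff_isUnit_det _).1 (posDef_of_smul_one_le hα₀ hW).isUnit), Matrix.one_mulVec]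

theorem steeringState_hasDerivWithinAt (hA : ContinuousOn A (Set.Icc a b))
    (hB : ContinuousOn B (Set.Icc a b)) {τ : ℝ} (hτ : τ ∈ Set.Icc a b) :
    HasDerivWithinAt (steeringState A B a b x₀)
      (A τ *ᵥ steeringState A B a b x₀ τ + B τ *ᵥ steeringControl A B a b x₀ τ)
      (Set.Icc a b) τ := by
  have haI : a ∈ Set.Icc a b := Set.left_mem_Icc.2 (hτ.1.trans hτ.2)
  refine (hasDerivWithinAt_mulVec (evolutionOperator_hasDerivWithinAt hA haI hτ)
    ((hasDerivWithinAt_mulVec_const (gramian_hasDerivWithinAt hA hB haI hτ)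
      ((gramian A B a b)⁻¹ *ᵥ x₀)).const_sub x₀)).congr_deriv ?_
  simp only [steeringState, steeringControl, Matrix.mulVec_neg, Matrix.mul_assoc,
    ← Matrix.mulVec_mulVec]
  rw [Matrix.mulVec_mulVec _ (evolutionOperator A τ a) (evolutionOperator A a τ),
    evolutionOperator_mul_swap hA haI hτ, Matrix.one_mulVec]

theorem steeringState_left : steeringState A B a b x₀ a = x₀ := by
  simp [steeringState, gramian_self, evolutionOperator_self]

theorem steeringState_right {α₀ : ℝ} (hα₀ : 0 < α₀) (hW : α₀ • 1 ≤ gramian A B a b) :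
    steeringState A B a b x₀ b = 0 := by
  rw [steeringState, gramian_mulVec_inv_mulVec hα₀ hW, sub_self, Matrix.mulVec_zero]

theorem steeringEnergy_hasDerivWithinAt (hA : ContinuousOn A (Set.Icc a b))
    (hB : ContinuousOn B (Set.Icc a b)) {τ : ℝ} (hτ : τ ∈ Set.Icc a b) :
    HasDerivWithinAt (steeringEnergy A B a b x₀)
      (steeringControl A B a b x₀ τ ⬝ᵥ steeringControl A B a b x₀ τ) (Set.Icc a b) τ := by
  have haI : a ∈ Set.Icc a b := Set.left_mem_Icc.2 (hτ.1.trans hτ.2)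
  refine (hasDerivWithinAt_dotProduct
    (hasDerivWithinAt_const τ (Set.Icc a b) ((gramian A B a b)⁻¹ *ᵥ x₀))
    (hasDerivWithinAt_mulVec_const (gramian_hasDerivWithinAt hA hB haI hτ)
      ((gramian A B a b)⁻¹ *ᵥ x₀))).congr_deriv ?_
  rw [steeringControl, neg_dotProduct_neg, zero_dotProduct, zero_add]
  simp only [Matrix.mul_assoc, ← Matrix.mulVec_mulVec]
  rw [Matrix.dotProduct_mulVec, ← Matrix.mulVec_transpose, Matrix.dotProduct_mulVec,
    ← Matrix.mulVec_transpose]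

theorem steeringEnergy_left : steeringEnergy A B a b x₀ a = 0 := by
  simp [steeringEnergy, gramian_self]

theorem steeringEnergy_right_le {α₀ : ℝ} (hα₀ : 0 < α₀) (hW : α₀ • 1 ≤ gramian A B a b) :
    steeringEnergy A B a b x₀ b ≤ 1 / α₀ * (x₀ ⬝ᵥ x₀) := by
  rw [steeringEnergy, gramian_mulVec_inv_mulVec hα₀ hW, dotProduct_comm]
  exact (abs_le.1 (abs_dotProduct_mulVec_le (norm_inv_le_of_smul_one_le hα₀ hW) x₀)).2

theorem steeringState_dotProduct_self_le (hA : ContinuousOn A (Set.Icc a b))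
    (hB : ContinuousOn B (Set.Icc a b)) {c α₀ α τ : ℝ} (hc : ∀ t ∈ Set.Icc a b, ‖A t‖ ≤ c)
    (hα₀ : 0 < α₀) (hW : α₀ • 1 ≤ gramian A B a b) (hτ : τ ∈ Set.Icc a b) (hα : 0 < α)
    (hWα : gramian A B a τ ≤ α • 1) :
    steeringState A B a b x₀ τ ⬝ᵥ steeringState A B a b x₀ τ ≤
      Real.exp (2 * c * (τ - a)) * ((1 + α / α₀) ^ 2 * (x₀ ⬝ᵥ x₀)) := by
  have hsub : Set.Icc a τ ⊆ Set.Icc a b := Set.Icc_subset_Icc_right hτ.2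
  have hΦ : ‖evolutionOperator A τ a‖ ≤ Real.exp (c * (τ - a)) :=
    norm_evolutionOperator_le hτ.1 (hA.mono hsub) fun t ht => hc t (hsub ht)
  have hGram : ‖1 - gramian A B a τ * (gramian A B a b)⁻¹‖ ≤ 1 + α / α₀ :=
    calc ‖1 - gramian A B a τ * (gramian A B a b)⁻¹‖
        ≤ ‖(1 : Matrix (Fin nx) (Fin nx) ℝ)‖ + ‖gramian A B a τ‖ * ‖(gramian A B a b)⁻¹‖ :=
          (norm_sub_le _ _).trans (add_le_add_right (Matrix.l2_opNorm_mul _ _) _)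
      _ ≤ 1 + α * (1 / α₀) := by
          gcongr
          · exact norm_one_le
          · exact norm_le_of_nonneg_of_le_smul_one hα
              (gramian_nonneg hτ.1 (hA.mono hsub) (hB.mono hsub)) hWα
          · exact norm_inv_le_of_smul_one_le hα₀ hW
      _ = 1 + α / α₀ := by rw [mul_one_div]
  have hstate : steeringState A B a b x₀ τ = evolutionOperator A τ a *ᵥ
      ((1 - gramian A B a τ * (gramian A B a b)⁻¹) *ᵥ x₀) := by
    rw [steeringState, Matrix.sub_mulVec, Matrix.one_mulVec, Matrix.mulVec_mulVec]
  calc steeringState A B a b x₀ τ ⬝ᵥ steeringState A B a b x₀ τ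
      ≤ Real.exp (c * (τ - a)) ^ 2 * ((1 + α / α₀) ^ 2 * (x₀ ⬝ᵥ x₀)) := by
        rw [hstate]
        exact (mulVec_dotProduct_self_le hΦ _).trans
          (mul_le_mul_of_nonneg_left (mulVec_dotProduct_self_le hGram x₀) (sq_nonneg _))
    _ = Real.exp (2 * c * (τ - a)) * ((1 + α / α₀) ^ 2 * (x₀ ⬝ᵥ x₀)) := by
        rw [← Real.exp_nat_mul, Nat.cast_ofNat, mul_assoc 2]

end Steering

namespace Constants

/-- Positivity of the constants that enter `c₀` and `c₁`. -/
structure IsPos (k : Constants) : Prop where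
  lamA_pos : 0 < k.lamA
  lamB_pos : 0 < k.lamB
  lamQ_pos : 0 < k.lamQ
  lamH_pos : 0 < k.lamH
  lamR_pos : 0 < k.lamR
  γR_pos : 0 < k.γR
  γQ_pos : 0 < k.γQ
  σ_pos : 0 < k.σ
  α₀_pos : 0 < k.α₀
  α₁_pos : 0 < k.α₁

namespace IsPos

variable {k : Constants}

theorem ω_pos (hk : k.IsPos) : 0 < k.ω :=
  add_pos hk.lamA_pos (div_pos (mul_pos hk.lamB_pos hk.lamH_pos) hk.γR_pos)

theorem lamA_le_ω (hk : k.IsPos) : k.lamA ≤ k.ω :=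
  le_add_of_nonneg_right (div_pos (mul_pos hk.lamB_pos hk.lamH_pos) hk.γR_pos).le

theorem exp_neg_lt_one (hk : k.IsPos) : Real.exp (-2 * k.ω * k.σ) < 1 :=
  Real.exp_lt_one_iff.2 (by linarith [mul_pos hk.ω_pos hk.σ_pos])

theorem αt₀_pos (hk : k.IsPos) : 0 < k.αt₀ :=
  mul_pos (one_div_pos.2 (mul_pos two_pos hk.ω_pos)) (sub_pos.2 hk.exp_neg_lt_one)

theorem αt₁_pos (hk : k.IsPos) : 0 < k.αt₁ :=
  mul_pos (one_div_pos.2 (mul_pos two_pos hk.ω_pos))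
    (sub_pos.2 (Real.one_lt_exp_iff.2 (mul_pos (mul_pos two_pos hk.ω_pos) hk.σ_pos)))

theorem two_div_α₀_le_inv_α₀' (hk : k.IsPos) : 2 / k.α₀ ≤ k.α₀'⁻¹ := by
  rw [α₀', inv_inv]
  have hexp : 1 ≤ Real.exp (2 * k.lamA * k.σ) :=
    Real.one_le_exp (mul_pos (mul_pos two_pos hk.lamA_pos) hk.σ_pos).le
  exact le_add_of_nonneg_right (mul_nonneg
    (mul_nonneg (div_nonneg (sq_nonneg _) hk.lamA_pos.le) (sq_nonneg _)) (sub_nonneg.2 hexp))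

theorem α₀'_pos (hk : k.IsPos) : 0 < k.α₀' :=
  inv_pos.1 ((div_pos two_pos hk.α₀_pos).trans_le hk.two_div_α₀_le_inv_α₀')

theorem α₀'_le_α₀ (hk : k.IsPos) : k.α₀' ≤ k.α₀ := by
  refine (inv_le_inv₀ hk.α₀_pos hk.α₀'_pos).1 (le_trans ?_ hk.two_div_α₀_le_inv_α₀')
  rw [← one_div]
  exact div_le_div_of_nonneg_right one_le_two hk.α₀_pos.le

theorem α₁'_pos (hk : k.IsPos) : 0 < k.α₁' :=
  div_pos (mul_pos (pow_pos hk.lamB_pos 2)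
    (sub_pos.2 (Real.one_lt_exp_iff.2 (mul_pos (mul_pos two_pos hk.σ_pos) hk.ω_pos))))
    (mul_pos two_pos hk.ω_pos)

theorem c₀_pos (hk : k.IsPos) : 0 < k.c₀ := by
  have hω := hk.ω_pos
  have hγR := hk.γR_pos
  have hγQ := hk.γQ_pos
  have hαt₀ := hk.αt₀_pos
  exact mul_pos (lt_min (by positivity) (by positivity)) (Real.exp_pos _)

theorem c₀_le_γQ (hk : k.IsPos) : k.c₀ ≤ k.γQ := by
  have hω := hk.ω_pos
  have hγR := hk.γR_pos
  have hγQ := hk.γQ_pos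
  have hmin : (k.lamB ^ 2 / (2 * k.γR * k.ω) + 1 / k.γQ)⁻¹ ≤ k.γQ :=
    inv_le_of_inv_le₀ hγQ (by rw [← one_div]; exact le_add_of_nonneg_left (by positivity))
  calc k.c₀ ≤ k.γQ * 1 := mul_le_mul ((min_le_right _ _).trans hmin) hk.exp_neg_lt_one.le
        (Real.exp_pos _).le hγQ.le
    _ = k.γQ := mul_one _

theorem c₀_mul_le (hk : k.IsPos) :
    k.c₀ * (k.lamB ^ 2 / k.γR * (1 + k.αt₁ / k.αt₀) ^ 2 + 1 / (k.γQ * k.αt₀ ^ 2)) ≤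
      2 * k.ω * Real.exp (-2 * k.ω * k.σ) := by
  have hαt₀ := hk.αt₀_pos
  have hγR := hk.γR_pos
  have hγQ := hk.γQ_pos
  set D := k.lamB ^ 2 / k.γR * (1 + k.αt₁ / k.αt₀) ^ 2 + 1 / (k.γQ * k.αt₀ ^ 2)
  have hD₀ : 0 < D := by positivity
  calc k.c₀ * D ≤ 2 * k.ω * D⁻¹ * Real.exp (-2 * k.ω * k.σ) * D :=
        mul_le_mul_of_nonneg_right (mul_le_mul_of_nonneg_right (min_le_left _ _)
          (Real.exp_pos _).le) hD₀.le
    _ = 2 * k.ω * Real.exp (-2 * k.ω * k.σ) := by field_simp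

theorem inputBound_mul_c₀_le (hk : k.IsPos) : k.lamB ^ 2 / k.γR * k.c₀ ≤ 2 * k.ω := by
  have hβ : 0 ≤ k.lamB ^ 2 / k.γR := div_nonneg (sq_nonneg _) hk.γR_pos.le
  have hκ : 1 ≤ (1 + k.αt₁ / k.αt₀) ^ 2 :=
    one_le_pow₀ (le_add_of_nonneg_right (div_pos hk.αt₁_pos hk.αt₀_pos).le)
  have hγα : 0 ≤ 1 / (k.γQ * k.αt₀ ^ 2) :=
    one_div_nonneg.2 (mul_nonneg hk.γQ_pos.le (sq_nonneg _))
  calc k.lamB ^ 2 / k.γR * k.c₀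
      ≤ k.c₀ * (k.lamB ^ 2 / k.γR * (1 + k.αt₁ / k.αt₀) ^ 2 + 1 / (k.γQ * k.αt₀ ^ 2)) := by
        rw [mul_comm]
        exact mul_le_mul_of_nonneg_left
          ((le_mul_of_one_le_right hβ hκ).trans (le_add_of_nonneg_right hγα)) hk.c₀_pos.le
    _ ≤ 2 * k.ω * Real.exp (-2 * k.ω * k.σ) := hk.c₀_mul_le
    _ ≤ 2 * k.ω := mul_le_of_le_one_right (mul_pos two_pos hk.ω_pos).le hk.exp_neg_lt_one.le

theorem two_mul_ω_mul_c₀_le (hk : k.IsPos) : 2 * k.ω * k.c₀ ≤ k.γQ / 2 := by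
  have hω := hk.ω_pos
  have hγQ := hk.γQ_pos
  have hαt₀ := hk.αt₀_pos
  have hβκ : 0 ≤ k.lamB ^ 2 / k.γR * (1 + k.αt₁ / k.αt₀) ^ 2 :=
    mul_nonneg (div_nonneg (sq_nonneg _) hk.γR_pos.le) (sq_nonneg _)
  have hc₀ : k.c₀ * (1 / (k.γQ * k.αt₀ ^ 2)) ≤ 2 * k.ω * Real.exp (-2 * k.ω * k.σ) :=
    (mul_le_mul_of_nonneg_left (le_add_of_nonneg_left hβκ) hk.c₀_pos.le).trans hk.c₀_mul_le
  have hαt₀_eq : 2 * k.ω * k.αt₀ = 1 - Real.exp (-2 * k.ω * k.σ) := by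
    rw [αt₀]; field_simp
  have hy₀ := Real.exp_pos (-2 * k.ω * k.σ)
  have hy₁ := hk.exp_neg_lt_one
  generalize Real.exp (-2 * k.ω * k.σ) = y at *
  have hcubic : y * (1 - y) ^ 2 ≤ 1 / 2 := by nlinarith [sq_nonneg (y - 1 / 2), sq_nonneg (1 - y)]
  calc 2 * k.ω * k.c₀
      = 2 * k.ω * (k.γQ * k.αt₀ ^ 2) * (k.c₀ * (1 / (k.γQ * k.αt₀ ^ 2))) := by field_simp
    _ ≤ 2 * k.ω * (k.γQ * k.αt₀ ^ 2) * (2 * k.ω * y) := by gcongr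
    _ = k.γQ * (y * (2 * k.ω * k.αt₀) ^ 2) := by ring
    _ = k.γQ * (y * (1 - y) ^ 2) := by rw [hαt₀_eq]
    _ ≤ k.γQ * (1 / 2) := by gcongr
    _ = k.γQ / 2 := mul_one_div _ _

theorem riccati_c₀_le (hk : k.IsPos) :
    k.lamB ^ 2 / k.γR * k.c₀ ^ 2 + 2 * k.ω * k.c₀ ≤ k.γQ := by
  have hquad := mul_le_mul_of_nonneg_right hk.inputBound_mul_c₀_le hk.c₀_pos.le
  linarith [hk.two_mul_ω_mul_c₀_le]

theorem c₁_pos (hk : k.IsPos) : 0 < k.c₁ := by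
  have hω := hk.ω_pos
  have hlamQ := hk.lamQ_pos
  have hγR := hk.γR_pos
  exact mul_pos (lt_max_of_lt_right (by positivity)) (Real.exp_pos _)

theorem le_c₁ (hk : k.IsPos) :
    k.lamQ * (1 + 1 / (2 * k.ω)) * Real.exp (2 * k.ω * k.σ) ≤ k.c₁ := by
  have hω := hk.ω_pos
  have hγR := hk.γR_pos
  refine mul_le_mul_of_nonneg_right (le_trans ?_ (le_max_right _ _)) (Real.exp_pos _).le
  exact mul_le_mul_of_nonneg_right (le_add_of_nonneg_right (by positivity)) (by positivity)

theorem steeringCost_le_c₁ (hk : k.IsPos) (hα : k.α₀ ≤ k.α₁') :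
    k.lamQ * (1 + k.α₁' / k.α₀) ^ 2 / (2 * k.ω) * Real.exp (2 * k.ω * k.σ) + k.lamR / k.α₀' ≤
      k.c₁ := by
  have hω := hk.ω_pos
  have hlamQ := hk.lamQ_pos
  have hlamR := hk.lamR_pos
  have hγR := hk.γR_pos
  have hα₀ := hk.α₀_pos
  have hα₀' := hk.α₀'_pos
  have hα₁' := hk.α₁'_pos
  have hle := hk.α₀'_le_α₀
  have hstate : k.lamQ * (1 + k.α₁' / k.α₀) ^ 2 ≤
      (k.lamQ + k.lamH ^ 2 / k.γR) * (1 + k.α₁' / k.α₀') ^ 2 := by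
    gcongr
    exact le_add_of_nonneg_right (by positivity)
  have hα₀'_le : k.α₀' ≤ k.lamB ^ 2 * (1 / (2 * k.ω)) * Real.exp (2 * k.ω * k.σ) :=
    calc k.α₀' ≤ k.α₁' := hle.trans hα
      _ = k.lamB ^ 2 * (1 / (2 * k.ω)) * (Real.exp (2 * k.ω * k.σ) - 1) := by
          rw [α₁', mul_right_comm 2 k.σ]; ring
      _ ≤ k.lamB ^ 2 * (1 / (2 * k.ω)) * Real.exp (2 * k.ω * k.σ) := by gcongr; linarith
  have hinput : k.lamR / k.α₀' ≤
      k.lamR * k.lamB ^ 2 / k.α₀' ^ 2 * (1 / (2 * k.ω)) * Real.exp (2 * k.ω * k.σ) :=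
    calc k.lamR / k.α₀' = k.lamR / k.α₀' ^ 2 * k.α₀' := by field_simp
      _ ≤ k.lamR / k.α₀' ^ 2 *
          (k.lamB ^ 2 * (1 / (2 * k.ω)) * Real.exp (2 * k.ω * k.σ)) := by gcongr
      _ = _ := by ring
  refine le_trans ?_ (mul_le_mul_of_nonneg_right (le_max_left _ _) (Real.exp_pos _).le)
  rw [add_mul, add_mul, div_eq_mul_one_div (k.lamQ * (1 + k.α₁' / k.α₀) ^ 2)]
  gcongr

end IsPos

end Constants

namespace Problem

section DataBounds

variable {nx nu : ℕ} {P : Problem nx nu} {k : Constants} {t : ℝ}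

/-- The drift `A - B R⁻¹ H` that remains after the cross term `2 uᵀ H x` of the running cost has
been removed by the feedback `u = w - R⁻¹ H x`. -/
noncomputable def drift (P : Problem nx nu) (t : ℝ) : Matrix (Fin nx) (Fin nx) ℝ :=
  P.A t - P.B t * (P.R t)⁻¹ * P.H t

/-- The matrix `B R⁻¹ Bᵀ` of the quadratic term of the Riccati equation. -/
noncomputable def inputWeight (P : Problem nx nu) (t : ℝ) : Matrix (Fin nx) (Fin nx) ℝ :=
  P.B t * (P.R t)⁻¹ * (P.B t)ᵀ

/-- The state weight `Q - Hᵀ R⁻¹ H` that remains after the cross term of the running cost has been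
removed. -/
noncomputable def stateWeight (P : Problem nx nu) (t : ℝ) : Matrix (Fin nx) (Fin nx) ℝ :=
  P.Q t - (P.H t)ᵀ * (P.R t)⁻¹ * P.H t

theorem isRiccatiSolution_iff {S : ℝ → Matrix (Fin nx) (Fin nx) ℝ} :
    P.IsRiccatiSolution S ↔
      SolvesRiccati P.drift P.inputWeight P.stateWeight S 0 P.T ∧ S P.T = P.QT := by
  have hassoc (t : ℝ) : S t * P.B t * (P.R t)⁻¹ * (P.B t)ᵀ * S t =
      S t * P.inputWeight t * S t := by simp only [inputWeight, Matrix.mul_assoc]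
  constructor
  · rintro ⟨hS, hT⟩
    exact ⟨fun t ht => (hS t ht).congr_deriv (by rw [hassoc]; rfl), hT⟩
  · rintro ⟨hS, hT⟩
    exact ⟨fun t ht => (hS t ht).congr_deriv (by rw [hassoc]; rfl), hT⟩

theorem closedLoop_eq (P : Problem nx nu) (S : ℝ → Matrix (Fin nx) (Fin nx) ℝ) :
    P.closedLoop S = fun t => P.drift t - P.inputWeight t * S t := rfl

theorem IsBounded.isPos (hbdd : P.IsBounded k) (hucc : P.IsUCC k) (hcoer : P.IsCoercive k) :
    k.IsPos :=
  { lamA_pos := hbdd.lamA_pos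
    lamB_pos := hbdd.lamB_pos
    lamQ_pos := hbdd.lamQ_pos
    lamH_pos := hbdd.lamH_pos
    lamR_pos := hbdd.lamR_pos
    γR_pos := hcoer.γR_pos
    γQ_pos := hcoer.γQ_pos
    σ_pos := hucc.σ_pos
    α₀_pos := hucc.α₀_pos
    α₁_pos := hucc.α₁_pos }

theorem IsCoercive.posDef_R (hcoer : P.IsCoercive k) (ht : t ∈ Set.Icc 0 P.T) :
    (P.R t).PosDef :=
  posDef_of_smul_one_le hcoer.γR_pos (hcoer.le_R t ht)

theorem IsCoercive.inv_R_nonneg (hcoer : P.IsCoercive k) (ht : t ∈ Set.Icc 0 P.T) :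
    0 ≤ (P.R t)⁻¹ :=
  inv_nonneg_of_smul_one_le hcoer.γR_pos (hcoer.le_R t ht)

theorem IsCoercive.norm_inv_R_le (hcoer : P.IsCoercive k) (ht : t ∈ Set.Icc 0 P.T) :
    ‖(P.R t)⁻¹‖ ≤ 1 / k.γR :=
  norm_inv_le_of_smul_one_le hcoer.γR_pos (hcoer.le_R t ht)

theorem continuousOn_inv_R (hbdd : P.IsBounded k) (hcoer : P.IsCoercive k) :
    ContinuousOn (fun t => (P.R t)⁻¹) (Set.Icc 0 P.T) :=
  continuousOn_matrix_inv hbdd.continuousOn_R fun _ ht => (hcoer.posDef_R ht).isUnit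

theorem continuousOn_drift (hbdd : P.IsBounded k) (hcoer : P.IsCoercive k) :
    ContinuousOn P.drift (Set.Icc 0 P.T) :=
  hbdd.continuousOn_A.sub (continuousOn_matrix_mul
    (continuousOn_matrix_mul hbdd.continuousOn_B (continuousOn_inv_R hbdd hcoer))
    hbdd.continuousOn_H)

theorem continuousOn_inputWeight (hbdd : P.IsBounded k) (hcoer : P.IsCoercive k) :
    ContinuousOn P.inputWeight (Set.Icc 0 P.T) :=
  continuousOn_matrix_mul
    (continuousOn_matrix_mul hbdd.continuousOn_B (continuousOn_inv_R hbdd hcoer))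
    (continuousOn_matrix_transpose hbdd.continuousOn_B)

theorem continuousOn_stateWeight (hbdd : P.IsBounded k) (hcoer : P.IsCoercive k) :
    ContinuousOn P.stateWeight (Set.Icc 0 P.T) :=
  hbdd.continuousOn_Q.sub (continuousOn_matrix_mul (continuousOn_matrix_mul
    (continuousOn_matrix_transpose hbdd.continuousOn_H) (continuousOn_inv_R hbdd hcoer))
    hbdd.continuousOn_H)

theorem norm_inv_R_mul_H_le (hbdd : P.IsBounded k) (hcoer : P.IsCoercive k)
    (ht : t ∈ Set.Icc 0 P.T) : ‖(P.R t)⁻¹ * P.H t‖ ≤ k.lamH / k.γR := by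
  have hγR := hcoer.γR_pos
  calc ‖(P.R t)⁻¹ * P.H t‖ ≤ ‖(P.R t)⁻¹‖ * ‖P.H t‖ := Matrix.l2_opNorm_mul _ _
    _ ≤ 1 / k.γR * k.lamH := by
        gcongr
        · exact hcoer.norm_inv_R_le ht
        · exact hbdd.norm_H_le t ht
    _ = k.lamH / k.γR := one_div_mul_eq_div _ _

theorem norm_drift_le (hbdd : P.IsBounded k) (hcoer : P.IsCoercive k) (ht : t ∈ Set.Icc 0 P.T) :
    ‖P.drift t‖ ≤ k.ω := by
  have hlamB := hbdd.lamB_pos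
  calc ‖P.drift t‖ ≤ ‖P.A t‖ + ‖P.B t‖ * ‖(P.R t)⁻¹ * P.H t‖ := by
        rw [drift, Matrix.mul_assoc]
        exact (norm_sub_le _ _).trans (add_le_add_right (Matrix.l2_opNorm_mul _ _) _)
    _ ≤ k.lamA + k.lamB * (k.lamH / k.γR) := by
        gcongr
        · exact hbdd.norm_A_le t ht
        · exact hbdd.norm_B_le t ht
        · exact norm_inv_R_mul_H_le hbdd hcoer ht
    _ = k.ω := by rw [← mul_div_assoc]; rfl

theorem inputWeight_nonneg (hcoer : P.IsCoercive k) (ht : t ∈ Set.Icc 0 P.T) :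
    0 ≤ P.inputWeight t :=
  nonneg_mul_mul_transpose (hcoer.inv_R_nonneg ht) (P.B t)

theorem inputWeight_le (hbdd : P.IsBounded k) (hcoer : P.IsCoercive k) (ht : t ∈ Set.Icc 0 P.T) :
    P.inputWeight t ≤ (k.lamB ^ 2 / k.γR) • 1 := by
  have hlamB := hbdd.lamB_pos
  have hγR := hcoer.γR_pos
  refine le_smul_one_of_norm_le (isSymm_of_nonneg (inputWeight_nonneg hcoer ht)) ?_
  calc ‖P.inputWeight t‖ ≤ ‖P.B t‖ * ‖(P.R t)⁻¹‖ * ‖P.B t‖ := by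
        rw [inputWeight]
        refine (Matrix.l2_opNorm_mul _ _).trans ?_
        rw [norm_transpose]
        exact mul_le_mul_of_nonneg_right (Matrix.l2_opNorm_mul _ _) (norm_nonneg _)
    _ ≤ k.lamB * (1 / k.γR) * k.lamB := by
        gcongr
        · exact hbdd.norm_B_le t ht
        · exact hcoer.norm_inv_R_le ht
        · exact hbdd.norm_B_le t ht
    _ = k.lamB ^ 2 / k.γR := by ring

theorem stateWeight_le (hbdd : P.IsBounded k) (hcoer : P.IsCoercive k) (ht : t ∈ Set.Icc 0 P.T) :
    P.stateWeight t ≤ k.lamQ • 1 := by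
  have hHRH : 0 ≤ (P.H t)ᵀ * (P.R t)⁻¹ * P.H t := by
    simpa only [Matrix.transpose_transpose] using
      nonneg_mul_mul_transpose (hcoer.inv_R_nonneg ht) (P.H t)ᵀ
  exact (sub_le_self _ hHRH).trans
    (le_smul_one_of_norm_le (hcoer.symm_Q t ht) (hbdd.norm_Q_le t ht))

end DataBounds

section RiccatiSolution

variable {nx nu : ℕ} {P : Problem nx nu} {k : Constants} {S : ℝ → Matrix (Fin nx) (Fin nx) ℝ}
  {t : ℝ}

theorem exists_isRiccatiSolution (hT : 0 ≤ P.T) (hbdd : P.IsBounded k)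
    (hcoer : P.IsCoercive k) : ∃ S, P.IsRiccatiSolution S := by
  obtain ⟨S, hS⟩ := exists_solvesRiccati hT (continuousOn_drift hbdd hcoer)
    (continuousOn_inputWeight hbdd hcoer) (continuousOn_stateWeight hbdd hcoer)
    (fun _ ht => inputWeight_nonneg hcoer ht)
    (fun t ht => (smul_nonneg hcoer.γQ_pos.le zero_le_one).trans (hcoer.le_Q t ht))
    (posDef_of_smul_one_le hcoer.γQ_pos hcoer.le_QT)
  exact ⟨S, isRiccatiSolution_iff.2 hS⟩

namespace IsRiccatiSolution

theorem solvesRiccati (hS : P.IsRiccatiSolution S) :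
    SolvesRiccati P.drift P.inputWeight P.stateWeight S 0 P.T :=
  (isRiccatiSolution_iff.1 hS).1

theorem eqOn {S' : ℝ → Matrix (Fin nx) (Fin nx) ℝ} (hbdd : P.IsBounded k)
    (hcoer : P.IsCoercive k) (hS : P.IsRiccatiSolution S) (hS' : P.IsRiccatiSolution S') :
    Set.EqOn S S' (Set.Icc 0 P.T) :=
  hS.solvesRiccati.eqOn (continuousOn_drift hbdd hcoer) (continuousOn_inputWeight hbdd hcoer)
    hS'.solvesRiccati (hS.terminal.trans hS'.terminal.symm)

theorem isSymm (hbdd : P.IsBounded k) (hcoer : P.IsCoercive k) (hS : P.IsRiccatiSolution S)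
    (ht : t ∈ Set.Icc 0 P.T) : (S t).IsSymm :=
  hS.solvesRiccati.isSymm (continuousOn_drift hbdd hcoer) (continuousOn_inputWeight hbdd hcoer)
    (fun _ hτ => isSymm_of_nonneg (inputWeight_nonneg hcoer hτ))
    (fun τ hτ => (smul_one_le_iff.1 (hcoer.le_Q τ hτ)).1) (hS.terminal ▸ hcoer.symm_QT) ht

theorem c₀_smul_one_le (hk : k.IsPos) (hbdd : P.IsBounded k) (hcoer : P.IsCoercive k)
    (hS : P.IsRiccatiSolution S) (ht : t ∈ Set.Icc 0 P.T) : k.c₀ • 1 ≤ S t :=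
  hS.solvesRiccati.smul_one_le (φ := fun _ => k.c₀) (φ' := 0) (continuousOn_drift hbdd hcoer)
    (continuousOn_inputWeight hbdd hcoer) (fun _ hτ => norm_drift_le hbdd hcoer hτ)
    (fun _ hτ => inputWeight_le hbdd hcoer hτ) hcoer.le_Q (fun _ _ => hk.c₀_pos.le)
    (fun τ _ => hasDerivWithinAt_const τ _ k.c₀)
    (fun _ _ => (sub_zero _).trans_le hk.riccati_c₀_le)
    (hS.terminal ▸ (smul_one_le_smul_one hk.c₀_le_γQ).trans hcoer.le_QT) ht

theorem le_exp_smul_one (hω : 0 < k.ω) (hbdd : P.IsBounded k) (hcoer : P.IsCoercive k)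
    (hS : P.IsRiccatiSolution S) (ht : t ∈ Set.Icc 0 P.T) :
    S t ≤ (k.lamQ * (1 + 1 / (2 * k.ω)) * Real.exp (2 * k.ω * (P.T - t))) • 1 := by
  have hlamQ := hbdd.lamQ_pos
  set C := k.lamQ * (1 + 1 / (2 * k.ω)) with hC
  have hCω : k.lamQ / (2 * k.ω) + k.lamQ = C := by rw [hC]; ring
  -- The scalar comparison function solves `φ' = -2 ω φ - λ_Q`, `φ(T) = λ_Q`.
  let φ := fun τ => C * Real.exp (-(2 * k.ω) * (τ - P.T)) - k.lamQ / (2 * k.ω)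
  have hφ : ∀ τ ∈ Set.Icc 0 P.T, HasDerivWithinAt φ
      (C * (-(2 * k.ω) * Real.exp (-(2 * k.ω) * (τ - P.T)))) (Set.Icc 0 P.T) τ := fun τ _ =>
    ((hasDerivWithinAt_exp_mul_sub (-(2 * k.ω)) P.T).const_mul C).sub_const _
  have hφ₀ : ∀ τ ∈ Set.Icc 0 P.T, 0 ≤ φ τ := fun τ hτ => by
    have hexp : 1 ≤ Real.exp (-(2 * k.ω) * (τ - P.T)) := Real.one_le_exp (by nlinarith [hτ.2])
    have := mul_le_mul_of_nonneg_left hexp (show 0 ≤ C by positivity)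
    simp only [φ]
    linarith
  have hφT : φ P.T = k.lamQ := by simp only [φ, sub_self, mul_zero, Real.exp_zero]; linarith
  have hle : S t ≤ φ t • 1 := hS.solvesRiccati.le_smul_one (continuousOn_drift hbdd hcoer)
    (continuousOn_inputWeight hbdd hcoer) (fun _ hτ => norm_drift_le hbdd hcoer hτ)
    (fun _ hτ => inputWeight_nonneg hcoer hτ) (fun _ hτ => stateWeight_le hbdd hcoer hτ) hφ₀ hφ
    (fun τ _ => by simp only [φ]; field_simp; linarith)
    (by rw [hS.terminal, hφT]; exact hcoer.QT_le) ht
  refine hle.trans (smul_one_le_smul_one ?_)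
  rw [show 2 * k.ω * (P.T - t) = -(2 * k.ω) * (t - P.T) by ring]
  exact sub_le_self _ (by positivity)

end IsRiccatiSolution

end RiccatiSolution

section UpperBound

variable {nx nu : ℕ} {P : Problem nx nu} {k : Constants} {S : ℝ → Matrix (Fin nx) (Fin nx) ℝ}
  {t t₁ : ℝ}

theorem drift_mulVec_add (P : Problem nx nu) (t : ℝ) (x : Fin nx → ℝ) (u : Fin nu → ℝ) :
    P.drift t *ᵥ x + P.B t *ᵥ (u + ((P.R t)⁻¹ * P.H t) *ᵥ x) = P.A t *ᵥ x + P.B t *ᵥ u := by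
  rw [drift, Matrix.sub_mulVec, Matrix.mulVec_add, Matrix.mulVec_mulVec, Matrix.mul_assoc]
  abel

theorem runningCost_le (hbdd : P.IsBounded k) (hcoer : P.IsCoercive k) (ht : t ∈ Set.Icc 0 P.T)
    (x : Fin nx → ℝ) (u : Fin nu → ℝ) :
    x ⬝ᵥ (P.stateWeight t *ᵥ x) +
        (u + ((P.R t)⁻¹ * P.H t) *ᵥ x) ⬝ᵥ (P.R t *ᵥ (u + ((P.R t)⁻¹ * P.H t) *ᵥ x)) ≤
      k.lamQ * (x ⬝ᵥ x) +
        k.lamR * (2 * (u ⬝ᵥ u) + 2 * ((k.lamH / k.γR) ^ 2 * (x ⬝ᵥ x))) := by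
  refine add_le_add ((le_smul_one_iff.1 (stateWeight_le hbdd hcoer ht)).2 x) ?_
  refine (le_abs_self _).trans ((abs_dotProduct_mulVec_le (hbdd.norm_R_le t ht) _).trans
    (mul_le_mul_of_nonneg_left ?_ hbdd.lamR_pos.le))
  exact (dotProduct_add_self_le _ _).trans (add_le_add_right (mul_le_mul_of_nonneg_left
    (mulVec_dotProduct_self_le (norm_inv_R_mul_H_le hbdd hcoer ht) x) zero_le_two) _)

theorem gramian_le_α₁' (hbdd : P.IsBounded k) (hω : k.lamA ≤ k.ω) (ht₁ : t₁ ∈ Set.Icc t (t + k.σ))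
    (hsub : Set.Icc t t₁ ⊆ Set.Icc 0 P.T) : gramian P.A P.B t t₁ ≤ k.α₁' • 1 := by
  have hω₀ : 0 < k.ω := hbdd.lamA_pos.trans_le hω
  refine (gramian_le_smul_one ht₁.1 (hbdd.continuousOn_A.mono hsub)
    (hbdd.continuousOn_B.mono hsub) hω₀ (fun τ hτ => (hbdd.norm_A_le τ (hsub hτ)).trans hω)
    fun τ hτ => hbdd.norm_B_le τ (hsub hτ)).trans (smul_one_le_smul_one ?_)
  have hσ : t₁ - t ≤ k.σ := sub_le_iff_le_add'.2 ht₁.2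
  rw [Constants.α₁', mul_right_comm 2 k.σ]
  gcongr

theorem α₀_le_α₁' [Nonempty (Fin nx)] (hbdd : P.IsBounded k) (hucc : P.IsUCC k)
    (hω : k.lamA ≤ k.ω) : k.α₀ ≤ k.α₁' := by
  obtain ⟨t₁, ht₁, hW₀, -⟩ := hucc.bounds 0 ⟨le_rfl, sub_nonneg.2 hucc.σ_lt.le⟩
  refine le_of_smul_one_le_smul_one (n := Fin nx) (hW₀.trans (gramian_le_α₁' hbdd hω ht₁ ?_))
  exact Set.Icc_subset_Icc_right (by linarith [ht₁.2, hucc.σ_lt])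

namespace IsRiccatiSolution

theorem dotProduct_mulVec_le_of_growth (hω : 0 < k.ω) (hbdd : P.IsBounded k)
    (hcoer : P.IsCoercive k) (hS : P.IsRiccatiSolution S) (htt₁ : t ≤ t₁)
    (hsub : Set.Icc t t₁ ⊆ Set.Icc 0 P.T) {x : ℝ → Fin nx → ℝ} {u : ℝ → Fin nu → ℝ}
    {E : ℝ → ℝ} {p q : ℝ}
    (hx : ∀ τ ∈ Set.Icc t t₁,
      HasDerivWithinAt x (P.A τ *ᵥ x τ + P.B τ *ᵥ u τ) (Set.Icc t t₁) τ)
    (hE : ∀ τ ∈ Set.Icc t t₁, HasDerivWithinAt E (u τ ⬝ᵥ u τ) (Set.Icc t t₁) τ)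
    (hp : ∀ τ ∈ Set.Icc t t₁, x τ ⬝ᵥ x τ ≤ Real.exp (2 * k.ω * (τ - t)) * p)
    (hq : ∀ τ ∈ Set.Icc t t₁, x τ ⬝ᵥ x τ ≤ Real.exp (2 * k.lamA * (τ - t)) * q) :
    x t ⬝ᵥ (S t *ᵥ x t) ≤ x t₁ ⬝ᵥ (S t₁ *ᵥ x t₁) +
      (k.lamQ * p / (2 * k.ω) * (Real.exp (2 * k.ω * (t₁ - t)) - 1) +
        k.lamR * (2 * (E t₁ - E t) + (k.lamH / k.γR) ^ 2 * q / k.lamA *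
          (Real.exp (2 * k.lamA * (t₁ - t)) - 1))) := by
  have hlamA := hbdd.lamA_pos
  let g := fun τ => k.lamQ * p / (2 * k.ω) * Real.exp (2 * k.ω * (τ - t)) +
    k.lamR * (2 * E τ + (k.lamH / k.γR) ^ 2 * q / k.lamA * Real.exp (2 * k.lamA * (τ - t)))
  have hg : ∀ τ ∈ Set.Icc t t₁, HasDerivWithinAt g
      (k.lamQ * (Real.exp (2 * k.ω * (τ - t)) * p) + k.lamR * (2 * (u τ ⬝ᵥ u τ) +
        2 * ((k.lamH / k.γR) ^ 2 * (Real.exp (2 * k.lamA * (τ - t)) * q))))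
      (Set.Icc t t₁) τ := fun τ hτ => by
    refine (((hasDerivWithinAt_exp_mul_sub (2 * k.ω) t).const_mul _).add
      ((((hE τ hτ).const_mul 2).add
        ((hasDerivWithinAt_exp_mul_sub (2 * k.lamA) t).const_mul _)).const_mul _)).congr_deriv ?_
    field_simp
  refine ((hS.solvesRiccati.mono hsub).dotProduct_mulVec_le_add_cost htt₁
    (fun τ hτ => hS.isSymm hbdd hcoer (hsub hτ)) (fun τ hτ => hcoer.posDef_R (hsub hτ))
    (fun τ hτ => (hx τ hτ).congr_deriv (P.drift_mulVec_add τ (x τ) (u τ)).symm) hg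
    fun τ hτ => ?_).trans_eq ?_
  · have hlamQ := hbdd.lamQ_pos
    have hlamR := hbdd.lamR_pos
    refine (runningCost_le hbdd hcoer (hsub hτ) _ _).trans ?_
    gcongr
    · exact hp τ hτ
    · exact hq τ hτ
  · simp only [g, sub_self, mul_zero, Real.exp_zero]
    ring

theorem dotProduct_mulVec_le_steeringCost (hk : k.IsPos) (hbdd : P.IsBounded k)
    (hcoer : P.IsCoercive k) (hS : P.IsRiccatiSolution S)
    (ht₁ : t₁ ∈ Set.Icc t (t + k.σ)) (hsub : Set.Icc t t₁ ⊆ Set.Icc 0 P.T)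
    (hW₀ : k.α₀ • 1 ≤ gramian P.A P.B t t₁) (hW₁ : gramian P.A P.B t t₁ ≤ k.α₁ • 1)
    (v : Fin nx → ℝ) :
    v ⬝ᵥ (S t *ᵥ v) ≤ (k.lamQ * (1 + k.α₁' / k.α₀) ^ 2 / (2 * k.ω) * Real.exp (2 * k.ω * k.σ) +
      k.lamR / k.α₀') * (v ⬝ᵥ v) := by
  have hA := hbdd.continuousOn_A.mono hsub
  have hB := hbdd.continuousOn_B.mono hsub
  have hAω : ∀ τ ∈ Set.Icc t t₁, ‖P.A τ‖ ≤ k.ω := fun τ hτ =>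
    (hbdd.norm_A_le τ (hsub hτ)).trans hk.lamA_le_ω
  have hW₁' := gramian_le_α₁' hbdd hk.lamA_le_ω ht₁ hsub
  have hle := hS.dotProduct_mulVec_le_of_growth hk.ω_pos hbdd hcoer ht₁.1 hsub
    (fun τ hτ => steeringState_hasDerivWithinAt (x₀ := v) hA hB hτ)
    (fun τ hτ => steeringEnergy_hasDerivWithinAt hA hB hτ)
    (fun τ hτ => steeringState_dotProduct_self_le hA hB hAω hk.α₀_pos hW₀ hτ hk.α₁'_pos
      ((gramian_mono hA hB hτ).trans hW₁'))
    (fun τ hτ => steeringState_dotProduct_self_le hA hB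
      (fun s hs => hbdd.norm_A_le s (hsub hs)) hk.α₀_pos hW₀ hτ hk.α₁_pos
      ((gramian_mono hA hB hτ).trans hW₁))
  rw [steeringState_left, steeringState_right hk.α₀_pos hW₀, zero_dotProduct, zero_add,
    steeringEnergy_left, sub_zero] at hle
  have hσ : t₁ - t ≤ k.σ := sub_le_iff_le_add'.2 ht₁.2
  have hlamA := hk.lamA_pos
  have hlamQ := hk.lamQ_pos
  have hlamR := hk.lamR_pos
  have hω := hk.ω_pos
  have hv := dotProduct_self_nonneg v
  calc v ⬝ᵥ (S t *ᵥ v)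
      ≤ k.lamQ * ((1 + k.α₁' / k.α₀) ^ 2 * (v ⬝ᵥ v)) / (2 * k.ω) * Real.exp (2 * k.ω * k.σ) +
        k.lamR * (2 * (1 / k.α₀ * (v ⬝ᵥ v)) +
          (k.lamH / k.γR) ^ 2 * ((1 + k.α₁ / k.α₀) ^ 2 * (v ⬝ᵥ v)) / k.lamA *
            (Real.exp (2 * k.lamA * k.σ) - 1)) := by
        refine hle.trans ?_
        gcongr
        · exact (sub_le_self _ zero_le_one).trans (Real.exp_le_exp.2 (by gcongr))
        · exact steeringEnergy_right_le hk.α₀_pos hW₀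
    _ = _ := by
        rw [Constants.α₀', div_inv_eq_mul]
        ring

theorem le_steeringCost (hk : k.IsPos) (hbdd : P.IsBounded k) (hucc : P.IsUCC k)
    (hcoer : P.IsCoercive k) (hS : P.IsRiccatiSolution S) (ht : t ∈ Set.Icc 0 (P.T - k.σ)) :
    S t ≤ (k.lamQ * (1 + k.α₁' / k.α₀) ^ 2 / (2 * k.ω) * Real.exp (2 * k.ω * k.σ) +
      k.lamR / k.α₀') • 1 := by
  obtain ⟨t₁, ht₁, hW₀, hW₁, -, -⟩ := hucc.bounds t ht
  have hsub : Set.Icc t t₁ ⊆ Set.Icc 0 P.T := Set.Icc_subset_Icc ht.1 (by linarith [ht.2, ht₁.2])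
  exact le_smul_one_iff.2 ⟨hS.isSymm hbdd hcoer (hsub (Set.left_mem_Icc.2 ht₁.1)),
    hS.dotProduct_mulVec_le_steeringCost hk hbdd hcoer ht₁ hsub hW₀ hW₁⟩

theorem le_c₁_smul_one (hk : k.IsPos) (hbdd : P.IsBounded k) (hucc : P.IsUCC k)
    (hcoer : P.IsCoercive k) (hS : P.IsRiccatiSolution S) (ht : t ∈ Set.Icc 0 P.T) :
    S t ≤ k.c₁ • 1 := by
  rcases isEmpty_or_nonempty (Fin nx) with hnx | hnx
  · exact (Subsingleton.elim _ _).le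
  have hω := hk.ω_pos
  rcases le_total t (P.T - k.σ) with htσ | htσ
  · exact (hS.le_steeringCost hk hbdd hucc hcoer ⟨ht.1, htσ⟩).trans
      (smul_one_le_smul_one (hk.steeringCost_le_c₁ (α₀_le_α₁' hbdd hucc hk.lamA_le_ω)))
  · refine (hS.le_exp_smul_one hω hbdd hcoer ht).trans
      (smul_one_le_smul_one (le_trans ?_ hk.le_c₁))
    have hlamQ := hk.lamQ_pos
    gcongr
    linarith

end IsRiccatiSolution

end UpperBound

end Problem

end LQControl

theorem mainTheorem6 (nx nu : ℕ) (k : LQControl.Constants) (P : LQControl.Problem nx nu)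
    (hbdd : P.IsBounded k) (hucc : P.IsUCC k) (hcoer : P.IsCoercive k) :
    ∃ S : ℝ → Matrix (Fin nx) (Fin nx) ℝ,
      P.IsRiccatiSolution S ∧
      (∀ S' : ℝ → Matrix (Fin nx) (Fin nx) ℝ,
        P.IsRiccatiSolution S' → Set.EqOn S' S (Set.Icc 0 P.T)) ∧
      ∀ t₀ t₁ : ℝ, 0 ≤ t₀ → t₀ ≤ t₁ → t₁ ≤ P.T →
        ‖LQControl.evolutionOperator (P.closedLoop S) t₁ t₀‖ ≤
          Real.sqrt (k.c₁ / k.c₀) * Real.exp (-(k.γQ / (2 * k.c₁)) * (t₁ - t₀)) := by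
  have hk : k.IsPos := hbdd.isPos hucc hcoer
  obtain ⟨S, hS⟩ := LQControl.Problem.exists_isRiccatiSolution
    (hucc.σ_pos.trans hucc.σ_lt).le hbdd hcoer
  refine ⟨S, hS, fun S' hS' => hS'.eqOn hbdd hcoer hS, fun t₀ t₁ h₀ h₀₁ h₁ => ?_⟩
  have hsub : Set.Icc t₀ t₁ ⊆ Set.Icc 0 P.T := Set.Icc_subset_Icc h₀ h₁
  rw [P.closedLoop_eq S]
  exact (hS.solvesRiccati.mono hsub).norm_evolutionOperator_closedLoop_le h₀₁
    ((LQControl.Problem.continuousOn_drift hbdd hcoer).mono hsub)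
    ((LQControl.Problem.continuousOn_inputWeight hbdd hcoer).mono hsub)
    (fun t ht => LQControl.Problem.inputWeight_nonneg hcoer (hsub ht))
    hcoer.γQ_pos.le hk.c₀_pos hk.c₁_pos (fun t ht => hcoer.le_Q t (hsub ht))
    (fun t ht => hS.c₀_smul_one_le hk hbdd hcoer (hsub ht))
    fun t ht => hS.le_c₁_smul_one hk hbdd hucc hcoer (hsub ht)
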